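/- Let $W'$ be the (non-unital) complex algebra with generators $x',y'$ and relations $(x'y'-y'x')y'=y'$, $x'(x'y'-y'x')=x'$; let $W$ be the Weyl algebra (unital, generated by $x,y$ with $xy-yx=1$), $\pi:W'\to W$ the homomorphism with $x'\mapsto x$, $y'\mapsto y$, and $I=\ker\pi$. Write $e=x'y'-y'x'$ (so $e=1+f$ with $f=x'y'-y'x'-1$ in the unitization of $W'$), and let $I_1\subset W'$ be the algebra of polynomials without constant term in $e$, regarded as a subalgebra of $\mathcal C^\infty[0,1]$ by $e\mapsto t$. Every $w\in W'$ is uniquely a finite sum $w=\sum_{k,l\ge 0} y'^k z_{kl}(e)\,x'^l$ with $z_{kl}\in\mathbb C[t]$ and $z_{00}(0)=0$. For $g\in\mathcal C^\infty[0,1]$ let $p_n(g)=\sum_{j=0}^n\frac1{j!}\sup_{[0,1]}|g^{(j)}|$. For $n\in\mathbb N$, a monotone increasing $\varphi:\mathbb N\to\mathbb R_+$ with $\varphi(l)\ge\sqrt{2(l+2)!}$ for all $l$, and $\psi:\mathbb N\to\mathbb R_+$ arbitrary, put $$\alpha_{\varphi,\psi}(w)=\alpha_{n,\varphi,\psi}(w)=\sum_{k,l}\varphi(k)\varphi(l)\,p_n\big(z_{kl}(t)-z_{kl}(1)\,t\big)+\sum_{k,l}\psi(k)\psi(l)\,|z_{kl}(1)|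 .$$ A locally convex algebra is a complex algebra with a complete Hausdorff locally convex topology and jointly continuous multiplication; it is an $m$-algebra if its topology is defined by submultiplicative seminorms. Theorem. Equip $W'$ with the locally convex topology defined by the seminorms $\alpha_{n,\varphi,\psi}$, and $W$ with the fine topology (all seminorms), with which it is a locally convex algebra. Then: (1) The topology of $W'$ is Hausdorff and the multiplication of $W'$ is jointly continuous. (2) There is a linear map $s:W\to W'$ with $s(y^nx^m)=y'^n e\,x'^m$ for all $n,m\ge 0$ and $\pi s=\mathrm{id}$, and $I\times W\to W'$, $(a,c)\mapsto a+s(c)$, is a homeomorphism. All the seminorms $\alpha_{n,\varphi,\psi}$ are submultiplicative on $I$. (3) The topology induced on $I_1$ by $W'$ is the one induced by the usual Fréchet topology of $\mathcal C^\infty[0,1]\supset I_1$. (4) $W'$ has a completion $\overline{W'}$ that is a locally convex algebra (a locally convex algebra containing $W'$ topologically as a dense subalgebra). $\pi$ extends to a continuous surjective homomorphism $\bar\pi:\overline{W'}\to W$ whose kernel is the closure $\bar I$ of $I$, and $s$, viewed as a map $W\to\overline{W'}$, is continuous linear with $\bar\pi s=\mathrm{id}$. Thus $0\to\bar I\to\overline{W'}\to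 W\to0$ is a linearly split extension of locally convex algebras. Moreover $\bar I$ is an $m$-algebra. (5) The closure of $I_1$ in $\overline{W'}$ (its completion) is isomorphic, as a topological algebra and by an isomorphism that sends $e$ to the function $t$, to $\{g\in\mathcal C^\infty[0,1]: g(0)=0\}$; as a locally convex space it is isomorphic to $\mathcal C^\infty[0,1]$. -/

import Mathlib

open Polynomial
open scoped ContDiff

noncomputable section

namespace WeylExtension

/-! ### Locally convex algebras -/

/-- A locally convex algebra: a (not necessarily unital) complex algebra with a complete
Hausdorff locally convex topology and jointly continuous multiplication. -/
class LocallyConvexAlgebra (A : Type*) [NonUnitalRing A] [Module ℂ A] [UniformSpace A] : Prop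
    extends IsScalarTower ℂ A A, SMulCommClass ℂ A A, IsUniformAddGroup A, ContinuousSMul ℂ A,
      PolynormableSpace ℂ A, ContinuousMul A, CompleteSpace A, T2Space A

instance (priority := 100) (A : Type*) [NonUnitalRing A] [Module ℂ A] [UniformSpace A]
    [LocallyConvexAlgebra A] : IsTopologicalRing A where

/-- An `m`-algebra: a locally convex algebra whose topology is defined by a family of
submultiplicative seminorms. -/
class IsMAlgebra (A : Type*) [NonUnitalRing A] [Module ℂ A] [UniformSpace A] : Prop
    extends LocallyConvexAlgebra A where
  exists_submultiplicative : ∃ S : Set (Seminorm ℂ A),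
    WithSeminorms (fun p : S => (p : Seminorm ℂ A)) ∧
      ∀ p ∈ S, ∀ a b : A, p (a * b) ≤ p a * p b

/-- The uniform structure defined by a family of seminorms. -/
abbrev seminormUniformSpace {E ι : Type*} [AddCommGroup E] [Module ℂ E]
    (p : ι → Seminorm ℂ E) : UniformSpace E :=
  ⨅ i, (p i).toSeminormedAddCommGroup.toUniformSpace

theorem seminormUniformSpace_isUniformAddGroup {E ι : Type*} [AddCommGroup E] [Module ℂ E]
    (p : ι → Seminorm ℂ E) : @IsUniformAddGroup E (seminormUniformSpace p) _ :=
  isUniformAddGroup_iInf fun i =>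
    @SeminormedAddCommGroup.to_isUniformAddGroup E (p i).toSeminormedAddCommGroup

theorem seminormUniformSpace_withSeminorms {E ι : Type*} [AddCommGroup E] [Module ℂ E]
    (p : ι → Seminorm ℂ E) :
    @WithSeminorms ℂ E ι _ _ _ p (seminormUniformSpace p).toTopologicalSpace := by
  let _ := seminormUniformSpace p
  have := seminormUniformSpace_isUniformAddGroup p
  exact (SeminormFamily.withSeminorms_iff_uniformSpace_eq_iInf (𝕜 := ℂ) p).2 rfl

/-! ### Smooth functions on the unit interval -/

/-- The complex-valued `C^∞` functions on `[0,1]` (one-sided derivatives at the endpoints). -/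
def smoothSubalgebra : Subalgebra ℂ (Set.Icc (0 : ℝ) 1 → ℂ) where
  carrier := {g | ContDiffOn ℝ ∞ (Set.IccExtend zero_le_one g) (Set.Icc 0 1)}
  mul_mem' hf hg := ContDiffOn.mul hf hg
  add_mem' hf hg := ContDiffOn.add hf hg
  algebraMap_mem' c := (contDiffOn_const (c := c)).congr fun _ _ => rfl

/-- The algebra `C^∞[0,1]`. (A separate type, so that it does not inherit the topology of
pointwise convergence.) -/
def Smooth : Type := smoothSubalgebra

instance : CommRing Smooth := inferInstanceAs (CommRing smoothSubalgebra)

instance : Algebra ℂ Smooth := inferInstanceAs (Algebra ℂ smoothSubalgebra)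

/-- The extension of `g ∈ C^∞[0,1]` to `ℝ` that is constant on both sides of `[0,1]`; only
its values on `[0,1]` are used. -/
def Smooth.ext (g : Smooth) : ℝ → ℂ := Set.IccExtend zero_le_one g.1

theorem Smooth.contDiffOn (g : Smooth) : ContDiffOn ℝ ∞ g.ext (Set.Icc 0 1) := g.2

/-- The `j`-th derivative of `g` on `[0,1]`. -/
def Smooth.deriv (j : ℕ) (g : Smooth) : Set.Icc (0 : ℝ) 1 → ℂ :=
  fun t => iteratedDerivWithin j g.ext (Set.Icc 0 1) t

theorem Smooth.deriv_add (j : ℕ) (g h : Smooth) : (g + h).deriv j = g.deriv j + h.deriv j := by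
  funext t
  exact iteratedDerivWithin_add t.2 (uniqueDiffOn_Icc zero_lt_one)
    ((g.contDiffOn t t.2).of_le (by exact_mod_cast le_top))
    ((h.contDiffOn t t.2).of_le (by exact_mod_cast le_top))

theorem Smooth.deriv_smul (j : ℕ) (c : ℂ) (g : Smooth) : (c • g).deriv j = c • g.deriv j := by
  funext t
  exact iteratedDerivWithin_const_smul_field c g.ext

theorem Smooth.bddAbove_deriv (j : ℕ) (g : Smooth) :
    BddAbove (Set.range fun t => ‖g.deriv j t‖) := by
  have hc : ContinuousOn (iteratedDerivWithin j g.ext (Set.Icc 0 1)) (Set.Icc 0 1) :=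
    g.contDiffOn.continuousOn_iteratedDerivWithin (by exact_mod_cast le_top)
      (uniqueDiffOn_Icc zero_lt_one)
  have hc' : Continuous (g.deriv j) := continuousOn_iff_continuous_domRestrict.1 hc
  exact (isCompact_range hc'.norm).bddAbove

/-- `g ↦ sup_{t ∈ [0,1]} |g^{(j)}(t)|`. -/
def supDeriv (j : ℕ) : Seminorm ℂ Smooth :=
  Seminorm.of (fun g => ⨆ t, ‖g.deriv j t‖)
    (fun g h => by
      refine ciSup_le fun t => ?_
      rw [Smooth.deriv_add]
      exact (norm_add_le _ _).trans
        (add_le_add (le_ciSup (g.bddAbove_deriv j) t) (le_ciSup (h.bddAbove_deriv j) t)))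
    (fun c g => by
      rw [Real.mul_iSup_of_nonneg (norm_nonneg c)]
      refine iSup_congr fun t => ?_
      rw [Smooth.deriv_smul, Pi.smul_apply, norm_smul])

/-- The seminorms `p_n(g) = ‖g‖ + ‖g'‖ + ½‖g''‖ + ⋯ + (1/n!)‖g^{(n)}‖` on `C^∞[0,1]`. -/
def pSeminorm (n : ℕ) : Seminorm ℂ Smooth :=
  ∑ j ∈ Finset.range (n + 1), ((j.factorial : NNReal)⁻¹) • supDeriv j

/-- The usual Fréchet topology of `C^∞[0,1]`. -/
instance : UniformSpace Smooth := seminormUniformSpace pSeminorm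

instance : IsUniformAddGroup Smooth := seminormUniformSpace_isUniformAddGroup _

/-- The coordinate function `t` on `[0,1]`. -/
def Smooth.t : Smooth := ⟨fun t => ((t : ℝ) : ℂ), by
  refine (Complex.ofRealCLM.contDiff.contDiffOn (s := Set.Icc (0 : ℝ) 1)).congr fun t ht => ?_
  rw [Set.IccExtend_of_mem _ _ ht]
  rfl⟩

/-- The restriction to `[0,1]` of a polynomial. -/
def polySmooth : ℂ[X] →ₐ[ℂ] Smooth := aeval Smooth.t

/-- The algebra of the `g ∈ C^∞[0,1]` with `g(0) = 0`. -/
def smoothVanishing : NonUnitalSubalgebra ℂ Smooth where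
  carrier := {g | g.1 ⟨0, by simp⟩ = 0}
  mul_mem' {g h} hg _ := by
    change g.1 _ * h.1 _ = 0
    rw [show g.1 _ = 0 from hg, zero_mul]
  add_mem' {g h} hg hh := by
    change g.1 _ + h.1 _ = 0
    rw [show g.1 _ = 0 from hg, show h.1 _ = 0 from hh, zero_add]
  zero_mem' := rfl
  smul_mem' c g hg := by
    change c • g.1 _ = 0
    rw [show g.1 _ = 0 from hg, smul_zero]

/-! ### The Weyl algebra and its extension -/

/-- The free unital algebra on two generators. -/
abbrev Free : Type := FreeAlgebra ℂ (Fin 2)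

/-- The first free generator. -/
abbrev gx : Free := FreeAlgebra.ι ℂ 0

/-- The second free generator. -/
abbrev gy : Free := FreeAlgebra.ι ℂ 1

/-- The relation `xy - yx = 1`. -/
inductive WeylRel : Free → Free → Prop
  | comm : WeylRel (gx * gy - gy * gx) 1

/-- The relations `(x'y' - y'x')y' = y'` and `x'(x'y' - y'x') = x'`. -/
inductive WPrimeRel : Free → Free → Prop
  | left : WPrimeRel ((gx * gy - gy * gx) * gy) gy
  | right : WPrimeRel (gx * (gx * gy - gy * gx)) gx

/-- The Weyl algebra `W`. -/
def W : Type := RingQuot WeylRel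

instance : Ring W := inferInstanceAs (Ring (RingQuot WeylRel))

instance : Algebra ℂ W := inferInstanceAs (Algebra ℂ (RingQuot WeylRel))

/-- The universal unital algebra with generators `x', y'` and the relations `WPrimeRel`.
As these relations have no constant term, it is `W'` with a unit adjoined. -/
def WTilde : Type := RingQuot WPrimeRel

instance : Ring WTilde := inferInstanceAs (Ring (RingQuot WPrimeRel))

instance : Algebra ℂ WTilde := inferInstanceAs (Algebra ℂ (RingQuot WPrimeRel))

/-- The quotient map onto `W`. -/
def mkW : Free →ₐ[ℂ] W := RingQuot.mkAlgHom ℂ WeylRel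

/-- The quotient map onto `WTilde`. -/
def mkT : Free →ₐ[ℂ] WTilde := RingQuot.mkAlgHom ℂ WPrimeRel

/-- The generator `x` of `W`. -/
def W.x : W := mkW gx

/-- The generator `y` of `W`. -/
def W.y : W := mkW gy

/-- The generator `x'`. -/
def xT : WTilde := mkT gx

/-- The generator `y'`. -/
def yT : WTilde := mkT gy

/-- The element `x'y' - y'x' = 1 + f`. -/
def eT : WTilde := xT * yT - yT * xT

/-- The non-unital algebra `W'` generated by `x', y'` with the relations `WPrimeRel`. -/
def WPrime : NonUnitalSubalgebra ℂ WTilde := NonUnitalAlgebra.adjoin ℂ {xT, yT}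

theorem eT_mul_yT : eT * yT = yT := by
  have h : mkT ((gx * gy - gy * gx) * gy) = mkT gy := RingQuot.mkAlgHom_rel ℂ WPrimeRel.left
  rwa [map_mul, map_sub, map_mul, map_mul] at h

theorem xT_mul_eT : xT * eT = xT := by
  have h : mkT (gx * (gx * gy - gy * gx)) = mkT gx := RingQuot.mkAlgHom_rel ℂ WPrimeRel.right
  rwa [map_mul, map_sub, map_mul, map_mul] at h

theorem W.x_mul_y : W.x * W.y - W.y * W.x = 1 := by
  have h : mkW (gx * gy - gy * gx) = mkW 1 := RingQuot.mkAlgHom_rel ℂ WeylRel.comm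
  rwa [map_sub, map_mul, map_mul, map_one] at h

theorem xT_mem : xT ∈ WPrime := NonUnitalAlgebra.subset_adjoin ℂ (by simp)

theorem yT_mem : yT ∈ WPrime := NonUnitalAlgebra.subset_adjoin ℂ (by simp)

theorem eT_mem : eT ∈ WPrime :=
  sub_mem (mul_mem xT_mem yT_mem) (mul_mem yT_mem xT_mem)

/-- The element `1 + f = x'y' - y'x'` of `W'`. -/
def WPrime.e : WPrime := ⟨eT, eT_mem⟩

/-- The unital homomorphism with `x' ↦ x`, `y' ↦ y`. -/
def piTilde : WTilde →ₐ[ℂ] W :=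
  RingQuot.liftAlgHom ℂ ⟨mkW, by
    have h : mkW (gx * gy - gy * gx) = 1 := by
      rw [map_sub, map_mul, map_mul]; exact W.x_mul_y
    intro a b hab
    cases hab with
    | left => rw [map_mul, h, one_mul]
    | right => rw [map_mul, h, mul_one]⟩

/-- The natural map `π : W' → W`. -/
def proj : WPrime →ₙₐ[ℂ] W :=
  (piTilde : WTilde →ₙₐ[ℂ] W).comp (NonUnitalSubalgebraClass.subtype WPrime)

/-- The kernel `I` of `π : W' → W`. -/
def idealI : NonUnitalSubalgebra ℂ WPrime :=
  (⊥ : NonUnitalSubalgebra ℂ W).comap proj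

/-- The subalgebra `I₁` of `W'`, consisting of the polynomials without constant term in
`1 + f = x'y' - y'x'`. -/
def algI₁ : NonUnitalSubalgebra ℂ WPrime := NonUnitalAlgebra.adjoin ℂ {WPrime.e}

/-! ### Coordinates

Every element of `WTilde` has a unique representation as a finite sum
`∑ y'^k z_{kl}(e) x'^l` with polynomials `z_{kl}`, where `e = x'y' - y'x' = 1 + f`. -/

/-- Finite families `(z_{kl})` of polynomials. -/
abbrev Coord : Type := ℕ × ℕ →₀ ℂ[X]

/-- `(z_{kl}) ↦ ∑ y'^k z_{kl}(e) x'^l`. -/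
def ofCoord : Coord →ₗ[ℂ] WTilde :=
  Finsupp.lsum ℂ fun kl =>
    LinearMap.mulLeftRight ℂ (yT ^ kl.1, xT ^ kl.2) ∘ₗ (aeval eT).toLinearMap

theorem ofCoord_single (k l : ℕ) (z : ℂ[X]) :
    ofCoord (Finsupp.single (k, l) z) = yT ^ k * aeval eT z * xT ^ l := by
  simp [ofCoord]

/-- Left multiplication by `y'` in coordinates. -/
def opY : Module.End ℂ Coord :=
  Finsupp.lsum ℂ fun kl => Finsupp.lsingle (kl.1 + 1, kl.2)

/-- `z ↦ z(1)`, as a constant polynomial. -/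
def evalC : ℂ[X] →ₗ[ℂ] ℂ[X] := Polynomial.CAlgHom.toLinearMap ∘ₗ Polynomial.leval 1

/-- Left multiplication by `x'` in coordinates. -/
def opX : Module.End ℂ Coord :=
  Finsupp.lsum ℂ fun kl =>
    match kl with
    | (0, l) => Finsupp.lsingle (0, l + 1) ∘ₗ evalC
    | (k + 1, l) => Finsupp.lsingle (k, l) ∘ₗ LinearMap.mulLeft ℂ (X + C (k : ℂ)) +
        Finsupp.lsingle (k + 1, l + 1) ∘ₗ evalC

theorem opY_single (k l : ℕ) (z : ℂ[X]) :
    opY (Finsupp.single (k, l) z) = Finsupp.single (k + 1, l) z := by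
  simp [opY]

theorem opX_single_zero (l : ℕ) (z : ℂ[X]) :
    opX (Finsupp.single (0, l) z) = Finsupp.single (0, l + 1) (C (z.eval 1)) := by
  simp [opX, evalC, Polynomial.leval]

theorem opX_single_succ (k l : ℕ) (z : ℂ[X]) :
    opX (Finsupp.single (k + 1, l) z) = Finsupp.single (k, l) ((X + C (k : ℂ)) * z) +
      Finsupp.single (k + 1, l + 1) (C (z.eval 1)) := by
  simp [opX, evalC, Polynomial.leval]

/-- Left multiplication by `e` in coordinates. -/
def opE : Module.End ℂ Coord := opX * opY - opY * opX

theorem opE_single_zero (l : ℕ) (z : ℂ[X]) :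
    opE (Finsupp.single (0, l) z) = Finsupp.single (0, l) (X * z) := by
  simp [opE, opY_single, opX_single_zero, opX_single_succ]

theorem opE_single_succ (k l : ℕ) (z : ℂ[X]) :
    opE (Finsupp.single (k + 1, l) z) = Finsupp.single (k + 1, l) z := by
  simp only [opE, LinearMap.sub_apply, Module.End.mul_apply, opY_single, opX_single_succ, map_add]
  rw [add_sub_add_right_eq_sub, ← Finsupp.single_sub]
  congr 1
  push_cast
  rw [map_add]
  simp
  ring

/-- `WTilde` acts on coordinates. -/
def act : WTilde →ₐ[ℂ] Module.End ℂ Coord :=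
  RingQuot.liftAlgHom ℂ ⟨FreeAlgebra.lift ℂ ![opX, opY], by
    intro a b hab
    cases hab with
    | left =>
      simp only [map_mul, map_sub, FreeAlgebra.lift_ι_apply]
      change opE * opY = opY
      refine Finsupp.lhom_ext fun kl z => ?_
      obtain ⟨k, l⟩ := kl
      rw [Module.End.mul_apply, opY_single, opE_single_succ]
    | right =>
      simp only [map_mul, map_sub, FreeAlgebra.lift_ι_apply]
      change opX * opE = opX
      refine Finsupp.lhom_ext fun kl z => ?_
      obtain ⟨k, l⟩ := kl
      cases k with
      | zero =>
        rw [Module.End.mul_apply, opE_single_zero, opX_single_zero, opX_single_zero, eval_mul,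
          eval_X, one_mul]
      | succ k => rw [Module.End.mul_apply, opE_single_succ]⟩

theorem act_xT : act xT = opX := by
  change RingQuot.liftAlgHom ℂ _ (RingQuot.mkAlgHom ℂ WPrimeRel gx) = _
  rw [RingQuot.liftAlgHom_mkAlgHom_apply, FreeAlgebra.lift_ι_apply]; rfl

theorem act_yT : act yT = opY := by
  change RingQuot.liftAlgHom ℂ _ (RingQuot.mkAlgHom ℂ WPrimeRel gy) = _
  rw [RingQuot.liftAlgHom_mkAlgHom_apply, FreeAlgebra.lift_ι_apply]; rfl

theorem act_eT : act eT = opE := by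
  rw [eT, map_sub, map_mul, map_mul, act_xT, act_yT, opE]

theorem xT_mul_yT : xT * yT = yT * xT + eT := by rw [eT]; abel

theorem xT_mul_yT_pow (k : ℕ) :
    xT * yT ^ (k + 1) = yT ^ k * (eT + algebraMap ℂ WTilde k) + yT ^ (k + 1) * xT := by
  induction k with
  | zero => simp [xT_mul_yT, add_comm]
  | succ k ih =>
    rw [pow_succ yT (k + 1), ← mul_assoc, ih, add_mul, mul_assoc _ _ yT, add_mul, eT_mul_yT,
      mul_assoc _ xT yT, xT_mul_yT, Algebra.commutes]
    simp only [Nat.cast_add, Nat.cast_one, map_add, map_one, mul_add, mul_one, pow_succ, mul_assoc]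
    abel

theorem xT_mul_aeval (z : ℂ[X]) : xT * aeval eT z = algebraMap ℂ WTilde (z.eval 1) * xT := by
  induction z using Polynomial.induction_on' with
  | add p q hp hq => rw [map_add, mul_add, hp, hq, eval_add, map_add, add_mul]
  | monomial n a =>
    have h : ∀ n : ℕ, xT * eT ^ n = xT := by
      intro n
      induction n with
      | zero => simp
      | succ n ih => rw [pow_succ, ← mul_assoc, ih, xT_mul_eT]
    rw [aeval_monomial, ← mul_assoc, ← Algebra.commutes, mul_assoc, h]
    simp

theorem ofCoord_opX (m : Coord) : ofCoord (opX m) = xT * ofCoord m := by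
  induction m using Finsupp.induction_linear with
  | zero => simp
  | add f g hf hg => rw [map_add, map_add, map_add, mul_add, hf, hg]
  | single kl z =>
    obtain ⟨k, l⟩ := kl
    cases k with
    | zero =>
      rw [opX_single_zero, ofCoord_single, ofCoord_single, aeval_C]
      simp only [pow_zero, one_mul]
      rw [← mul_assoc, xT_mul_aeval, mul_assoc, pow_succ']
    | succ k =>
      rw [opX_single_succ, map_add, ofCoord_single, ofCoord_single, ofCoord_single, map_mul, map_add,
        aeval_X, aeval_C, aeval_C, ← mul_assoc, ← mul_assoc, ← mul_assoc xT, xT_mul_yT_pow, add_mul, add_mul,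
        mul_assoc (yT ^ (k + 1)) xT, xT_mul_aeval, pow_succ' xT]
      simp only [mul_assoc]

theorem ofCoord_opY (m : Coord) : ofCoord (opY m) = yT * ofCoord m := by
  induction m using Finsupp.induction_linear with
  | zero => simp
  | add f g hf hg => rw [map_add, map_add, map_add, mul_add, hf, hg]
  | single kl z =>
    obtain ⟨k, l⟩ := kl
    rw [opY_single, ofCoord_single, ofCoord_single, pow_succ']
    simp only [mul_assoc]

theorem ofCoord_act (w : WTilde) (m : Coord) : ofCoord (act w m) = w * ofCoord m := by
  obtain ⟨a, rfl⟩ := RingQuot.mkAlgHom_surjective ℂ WPrimeRel w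
  change ofCoord (act (mkT a) m) = mkT a * ofCoord m
  induction a using FreeAlgebra.induction generalizing m with
  | grade0 r =>
    rw [AlgHom.commutes, AlgHom.commutes, Module.algebraMap_end_apply, map_smul, Algebra.smul_def]
  | grade1 i =>
    fin_cases i
    · change ofCoord (act xT m) = xT * _
      rw [act_xT, ofCoord_opX]
    · change ofCoord (act yT m) = yT * _
      rw [act_yT, ofCoord_opY]
  | mul a b ha hb => rw [map_mul, map_mul, Module.End.mul_apply, ha, hb, mul_assoc]
  | add a b ha hb => rw [map_add, map_add, LinearMap.add_apply, map_add, ha, hb, add_mul]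

theorem act_ofCoord (m : Coord) : act (ofCoord m) (Finsupp.single (0, 0) 1) = m := by
  induction m using Finsupp.induction_linear with
  | zero => simp
  | add f g hf hg => rw [map_add, map_add, LinearMap.add_apply, hf, hg]
  | single kl z =>
    obtain ⟨k, l⟩ := kl
    have hx : ∀ l : ℕ, (opX ^ l) (Finsupp.single (0, 0) 1) = Finsupp.single (0, l) 1 := by
      intro l
      induction l with
      | zero => simp
      | succ l ih => rw [pow_succ', Module.End.mul_apply, ih, opX_single_zero]; simp
    have he : ∀ (l : ℕ) (z q : ℂ[X]),
        aeval opE z (Finsupp.single (0, l) q) = Finsupp.single (0, l) (z * q) := by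
      intro l z q
      induction z using Polynomial.induction_on' with
      | add p r hp hr => rw [map_add, LinearMap.add_apply, hp, hr, add_mul, Finsupp.single_add]
      | monomial n a =>
        have h : ∀ n : ℕ,
            (opE ^ n) (Finsupp.single (0, l) q) = Finsupp.single (0, l) (X ^ n * q) := by
          intro n
          induction n with
          | zero => simp
          | succ n ih => rw [pow_succ', Module.End.mul_apply, ih, opE_single_zero, pow_succ',
              mul_assoc]
        rw [aeval_monomial, Module.End.mul_apply, h, Module.algebraMap_end_apply,
          Finsupp.smul_single, ← C_mul_X_pow_eq_monomial, smul_eq_C_mul, mul_assoc]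
    have hy : ∀ (k l : ℕ) (q : ℂ[X]),
        (opY ^ k) (Finsupp.single (0, l) q) = Finsupp.single (k, l) q := by
      intro k l q
      induction k with
      | zero => simp
      | succ k ih => rw [pow_succ', Module.End.mul_apply, ih, opY_single]
    rw [ofCoord_single, map_mul, map_mul, map_pow, map_pow, act_xT, act_yT,
      ← aeval_algHom_apply, act_eT, Module.End.mul_apply, Module.End.mul_apply, hx, he, hy, mul_one]

/-- The coordinates `(z_{kl})` of `w = ∑ y'^k z_{kl}(e) x'^l`. -/
def coordEquiv : WTilde ≃ₗ[ℂ] Coord :=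
  LinearEquiv.symm
    { ofCoord with
      invFun := fun w => act w (Finsupp.single (0, 0) 1)
      left_inv := act_ofCoord
      right_inv := fun w => by
        change ofCoord (act w _) = w
        rw [ofCoord_act, ofCoord_single]
        simp }

theorem coordEquiv_symm_apply (m : Coord) :
    coordEquiv.symm m = m.sum fun kl z => yT ^ kl.1 * aeval eT z * xT ^ kl.2 := by
  change ofCoord m = _
  rw [ofCoord, Finsupp.lsum_apply]
  rfl

/-! ### The seminorms -/

/-- The seminorm `(z_i) ↦ ∑ q_i(z_i)` on finite families. -/
def sumSeminorm {ι E : Type*} [AddCommGroup E] [Module ℂ E] (q : ι → Seminorm ℂ E) :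
    Seminorm ℂ (ι →₀ E) :=
  Seminorm.of (fun v => v.sum fun i z => q i z)
    (fun v w => by
      classical
      have h : ∀ u : ι →₀ E, u.support ⊆ v.support ∪ w.support →
          (u.sum fun i z => q i z) = ∑ i ∈ v.support ∪ w.support, q i (u i) := fun u hu =>
        Finsupp.sum_of_support_subset u hu _ fun i _ => map_zero (q i)
      rw [h _ Finsupp.support_add, h v Finset.subset_union_left, h w Finset.subset_union_right,
        ← Finset.sum_add_distrib]
      exact Finset.sum_le_sum fun i _ => map_add_le_add (q i) _ _)
    (fun c v => by
      rw [Finsupp.sum_of_support_subset (c • v) Finsupp.support_smul _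
        fun i _ => map_zero (q i), Finsupp.sum, Finset.mul_sum]
      exact Finset.sum_congr rfl fun i _ => map_smul_eq_mul (q i) c _)

/-- The component in `I` of `y'^k z(e) x'^l`, in coordinates: `z(t) - z(1) t`. -/
def partI : ℂ[X] →ₗ[ℂ] ℂ[X] := LinearMap.id - LinearMap.mulRight ℂ X ∘ₗ evalC

/-- `β_φ(∑ y'^k z_{kl}(e) x'^l) = ∑ φ(k) φ(l) β(z_{kl})` for `β = p_n`. -/
def betaCoord (n : ℕ) (φ : ℕ → NNReal) : Seminorm ℂ Coord :=
  sumSeminorm fun kl =>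
    (φ kl.1 * φ kl.2) • (pSeminorm n).comp polySmooth.toLinearMap

/-- `α_ψ(∑ λ_{kl} y'^k (1 + f) x'^l) = ∑ ψ(k) ψ(l) |λ_{kl}|`. -/
def alphaCoord (ψ : ℕ → NNReal) : Seminorm ℂ (ℕ × ℕ →₀ ℂ) :=
  sumSeminorm fun kl => (ψ kl.1 * ψ kl.2) • normSeminorm ℂ ℂ

/-- The parameters of the seminorms: `n` (for `β = p_n`), a monotone `φ : ℕ → ℝ₊` with
`φ(l) ≥ √(2 (l+2)!)`, and an arbitrary `ψ : ℕ → ℝ₊`. -/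
structure Param where
  n : ℕ
  φ : ℕ → NNReal
  ψ : ℕ → NNReal
  mono : Monotone φ
  bound : ∀ l : ℕ, Real.sqrt (2 * (l + 2).factorial) ≤ φ l

/-- The component of `w` in `I`, in coordinates. -/
def coordI : WPrime →ₗ[ℂ] Coord :=
  Finsupp.mapRange.linearMap partI ∘ₗ coordEquiv.toLinearMap ∘ₗ WPrime.toSubmodule.subtype

/-- The coefficients `λ_{kl} = z_{kl}(1)` of the component `∑ λ_{kl} y'^k (1 + f) x'^l`
of `w` in the complement `s(W)` of `I`. -/
def coordS : WPrime →ₗ[ℂ] (ℕ × ℕ →₀ ℂ) :=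
  Finsupp.mapRange.linearMap (Polynomial.leval 1) ∘ₗ coordEquiv.toLinearMap ∘ₗ
    WPrime.toSubmodule.subtype

/-- The seminorms `α_{φ,ψ}(a + b) = β_φ(a) + α_ψ(b)`, `a ∈ I`, `b ∈ s(W)`, on `W'`. -/
def alpha (i : Param) : Seminorm ℂ WPrime :=
  (betaCoord i.n i.φ).comp coordI + (alphaCoord i.ψ).comp coordS

/-- The locally convex structure of `W'` given by the seminorms `α_{φ,ψ}`. -/
instance : UniformSpace WPrime := seminormUniformSpace alpha

instance : IsUniformAddGroup WPrime := seminormUniformSpace_isUniformAddGroup _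

/-- The fine locally convex structure of `W`, given by all seminorms. -/
instance : UniformSpace W := seminormUniformSpace fun p : Seminorm ℂ W => p

instance : IsUniformAddGroup W := seminormUniformSpace_isUniformAddGroup _

theorem e_mem_algI₁ : WPrime.e ∈ algI₁ := NonUnitalAlgebra.subset_adjoin ℂ (by simp)

theorem t_mem_smoothVanishing : Smooth.t ∈ smoothVanishing := by
  change ((0 : ℝ) : ℂ) = 0
  simp

end WeylExtension

end

open WeylExtension

noncomputable section

namespace WeylExtension

open Filter Topology

/-! ### Locally convex spaces given by seminorms -/

/-! The whole situation is carried into one explicit complete algebra. In normal form `∑ y'^k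
z_{kl}(e) x'^l` the product is governed by three rules: `x' y'^(k+1) = y'^k (e + k) + y'^(k+1) x'`,
`x' z(e) = z(1) x'`, and `z(e) y'^(k+1) = z(1) y'^(k+1)`. They make sense for smooth `z`, so the
product extends to `SCoord`, the finite families of elements of `C^∞[0,1]`, with the seminorms `∑
Φ(k,l) p_n(z_{kl})` for arbitrary weights `Φ` (the direct sum topology). This space is complete
(`completeSpace_weighted`) because `C^∞[0,1]` is, and its product is jointly continuous
(`exists_weighted_mulS_le`). Polynomials are dense in `C^∞[0,1]`, so the unitization of `W'` is
dense in `SCoord`, and identities such as associativity and multiplicativity of `π` extend by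
continuity.

The seminorms `α_{n,φ,ψ}` define this same topology (`withSeminorms_alphaS`): every weight `Φ(k,l)`
is dominated by some `φ(k) φ(l)` with `φ` monotone and as large as required, and `z` is controlled
by `z - z(1) t` together with `z(1)`. Hence `W'` embeds topologically in `SCoord`, and its closure
there is the completion.

Since `π(e) = 1`, the coordinates of `π(w)` in the basis `y^k x^l` are the values `z_{kl}(1)`. Thus
`π` extends to `SCoord`, and `I` consists of the elements whose coefficients all vanish at `1`.
Linear maps out of the fine topology of `W` are automatically continuous, so the splitting `s` is,
and the decompositions of `W'` and of its completion follow from the projection `w ↦ w - s(π w)`.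

Submultiplicativity on `I` (`betaS_mulS_single_le`): if `a(1) = b(1) = 0`, then `y'^k a(e) x'^l ·
y'^m b(e) x'^n` is zero unless `l = m`. In that case `x'^l y'^l b(e)` is `b(e)` times the product of
the `e + j` for `j < l`, which costs at most `(l+1)! ≤ φ(l)^2`.

Finally, `I₁` lies in the single coordinate `(0,0)`, a topological copy of `C^∞[0,1]`. Its closure
there is `{g : g(0) = 0}`, and integration from `0`, with inverse differentiation, identifies that
space with `C^∞[0,1]`. -/

theorem cauchy_iff_seminorm {E ι : Type*} [AddCommGroup E] [Module ℂ E] [UniformSpace E]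
    [IsUniformAddGroup E] {p : ι → Seminorm ℂ E} (hp : WithSeminorms p) {f : Filter E} [NeBot f] :
    Cauchy f ↔ ∀ i, ∀ ε > 0, ∃ A ∈ f, ∀ v ∈ A, ∀ w ∈ A, p i (v - w) < ε := by
  rw [IsUniformAddGroup.cauchy_iff_tendsto, hp.tendsto_nhds]
  simp only [sub_zero]
  constructor
  · rintro ⟨-, h⟩ i ε hε
    obtain ⟨A, hA, h'⟩ := mem_prod_self_iff.1 (h i ε hε)
    exact ⟨A, hA, fun v hv w hw => h' (Set.mk_mem_prod hv hw)⟩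
  · intro h
    refine ⟨inferInstance, fun i ε hε => ?_⟩
    obtain ⟨A, hA, h'⟩ := h i ε hε
    exact mem_prod_self_iff.2 ⟨A, hA, fun vw hvw => h' _ hvw.1 _ hvw.2⟩

theorem continuous_of_seminorm_le {E F ι : Type*} [AddCommGroup E] [Module ℂ E]
    [TopologicalSpace E] [IsTopologicalAddGroup E] [AddCommGroup F] [Module ℂ F]
    [TopologicalSpace F] {q : ι → Seminorm ℂ F} (hq : WithSeminorms q) (f : E →ₗ[ℂ] F)
    (h : ∀ i, ∃ p : Seminorm ℂ E, Continuous p ∧ ∀ x, q i (f x) ≤ p x) : Continuous f := by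
  refine hq.continuous_of_continuous_comp f fun i => ?_
  obtain ⟨p, hp, hle⟩ := h i
  exact Seminorm.continuous_of_le hp fun x => hle x

/-- The seminorm `q` on the right may differ from `p i`: the bound is applied to both terms of `ab -
a₀b₀ = (a - a₀)b + a₀(b - b₀)`. -/
theorem continuousMul_of_seminorm_le {A ι : Type*} [NonUnitalNonAssocRing A] [Module ℂ A]
    [TopologicalSpace A] {p : ι → Seminorm ℂ A} (hp : WithSeminorms p)
    (h : ∀ i, ∃ q : Seminorm ℂ A, Continuous q ∧ ∀ a b, p i (a * b) ≤ q a * q b) :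
    ContinuousMul A := by
  have := hp.topologicalAddGroup
  refine ⟨continuous_iff_continuousAt.2 fun ab => ?_⟩
  obtain ⟨a, b⟩ := ab
  refine (hp.tendsto_nhds _ _).2 fun i ε hε => ?_
  obtain ⟨q, hq, hle⟩ := h i
  have hlim : Tendsto (fun x : A × A => q (x.1 - a) * q x.2 + q a * q (x.2 - b)) (𝓝 (a, b))
      (𝓝 (q (a - a) * q b + q a * q (b - b))) :=
    Continuous.tendsto (by fun_prop) (a, b)
  rw [sub_self, sub_self, map_zero, zero_mul, mul_zero, add_zero] at hlim
  filter_upwards [hlim.eventually_lt_const hε] with x hx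
  refine lt_of_le_of_lt ?_ hx
  have : x.1 * x.2 - a * b = (x.1 - a) * x.2 + a * (x.2 - b) := by
    rw [sub_mul, mul_sub]; abel
  change p i (x.1 * x.2 - a * b) ≤ _
  rw [this]
  exact (map_add_le_add _ _ _).trans (add_le_add (hle _ _) (hle _ _))

theorem withSeminorms_of_le {E ι κ : Type*} [AddCommGroup E] [Module ℂ E]
    [TopologicalSpace E] {p : ι → Seminorm ℂ E} {q : κ → Seminorm ℂ E} (hp : WithSeminorms p)
    (hpq : ∀ j, ∃ i, ∃ C : NNReal, q j ≤ C • p i)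
    (hqp : ∀ i, ∃ j, ∃ C : NNReal, p i ≤ C • q j) : WithSeminorms q := by
  refine hp.congr (fun j => ?_) fun i => ?_
  · obtain ⟨i, C, h⟩ := hpq j
    exact ⟨{i}, C, by simpa using h⟩
  · obtain ⟨i, C, h⟩ := hqp i
    exact ⟨{i}, C, by simpa using h⟩

theorem t2Space_of_seminorm {E ι : Type*} [AddCommGroup E] [Module ℂ E]
    [TopologicalSpace E] {p : ι → Seminorm ℂ E} (hp : WithSeminorms p)
    (h : ∀ x, (∀ i, p i x = 0) → x = 0) : T2Space E := by
  have := hp.topologicalAddGroup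
  have := hp.T1_of_separating fun x hx => by
    by_contra! h'
    exact hx (h x h')
  infer_instance

/-! ### Finite families -/

section Family

variable {ι E : Type*} [AddCommGroup E] [Module ℂ E]

theorem sumSeminorm_single (q : ι → Seminorm ℂ E) (i : ι) (z : E) :
    sumSeminorm q (Finsupp.single i z) = q i z := by
  exact Finsupp.sum_single_index (h := fun i z => q i z) (map_zero (q i))

theorem sumSeminorm_eq_sum (q : ι → Seminorm ℂ E) (v : ι →₀ E) {s : Finset ι}
    (hs : v.support ⊆ s) : sumSeminorm q v = ∑ i ∈ s, q i (v i) :=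
  Finsupp.sum_of_support_subset v hs _ fun i _ => map_zero (q i)

theorem le_sumSeminorm (q : ι → Seminorm ℂ E) (v : ι →₀ E) (i : ι) :
    q i (v i) ≤ sumSeminorm q v := by
  classical
  rw [sumSeminorm_eq_sum q v (Finset.subset_insert i v.support)]
  exact Finset.single_le_sum (f := fun i => q i (v i)) (fun j _ => apply_nonneg _ _)
    (Finset.mem_insert_self _ _)

theorem sumSeminorm_mono {q r : ι → Seminorm ℂ E} (h : ∀ i z, q i z ≤ r i z) (v : ι →₀ E) :
    sumSeminorm q v ≤ sumSeminorm r v :=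
  Finset.sum_le_sum fun i _ => h i _

theorem seminorm_sum_le {F κ : Type*} [AddCommGroup F] [Module ℂ F] (q : Seminorm ℂ F)
    (s : Finset κ) (f : κ → F) : q (∑ i ∈ s, f i) ≤ ∑ i ∈ s, q (f i) :=
  Finset.le_sum_of_subadditive q (map_zero q).le (fun a b => map_add_le_add q a b) s f

theorem seminorm_le_sumSeminorm (p : Seminorm ℂ (ι →₀ E)) (q : ι → Seminorm ℂ E)
    (h : ∀ i z, p (Finsupp.single i z) ≤ q i z) (v : ι →₀ E) : p v ≤ sumSeminorm q v := by
  conv_lhs => rw [← Finsupp.sum_single v]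
  exact (seminorm_sum_le p _ _).trans (Finset.sum_le_sum fun i _ => h i _)

/-- The seminorms `v ↦ ∑ Φ(i) p_k(v_i)` on finite families, for arbitrary weights `Φ`. -/
def weighted {κ : Type*} (p : κ → Seminorm ℂ E) (j : κ × (ι → NNReal)) : Seminorm ℂ (ι →₀ E) :=
  sumSeminorm fun i => j.2 i • p j.1

theorem weighted_single {κ : Type*} (p : κ → Seminorm ℂ E) (k : κ) (Φ : ι → NNReal) (i : ι)
    (z : E) : weighted p (k, Φ) (Finsupp.single i z) = Φ i * p k z :=
  sumSeminorm_single _ _ _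

theorem le_weighted {κ : Type*} (p : κ → Seminorm ℂ E) (k : κ) (Φ : ι → NNReal) (i : ι)
    (v : ι →₀ E) : Φ i * p k (v i) ≤ weighted p (k, Φ) v :=
  le_sumSeminorm (fun i => Φ i • p k) v i

theorem weighted_eq_sum {κ : Type*} (p : κ → Seminorm ℂ E) (k : κ) (Φ : ι → NNReal)
    (v : ι →₀ E) : weighted p (k, Φ) v = ∑ i ∈ v.support, Φ i * p k (v i) := rfl

/-- A Cauchy filter converges coordinatewise. Because the weights are arbitrary, the coordinatewise
limit is forced to have finite support, and then the uniform bounds on finite partial sums give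
convergence in every seminorm. -/
theorem completeSpace_weighted {κ : Type*} [UniformSpace E] [IsUniformAddGroup E]
    [CompleteSpace E] {p : κ → Seminorm ℂ E} (hp : WithSeminorms p) (k₀ : κ)
    (h₀ : ∀ z, p k₀ z = 0 → z = 0) :
    @CompleteSpace (ι →₀ E) (seminormUniformSpace (weighted p)) := by
  classical
  let _ : UniformSpace (ι →₀ E) := seminormUniformSpace (weighted p)
  have : IsUniformAddGroup (ι →₀ E) := seminormUniformSpace_isUniformAddGroup _
  have hw : WithSeminorms (weighted p : κ × (ι → NNReal) → Seminorm ℂ (ι →₀ E)) :=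
    seminormUniformSpace_withSeminorms _
  refine ⟨fun {f} hf => ?_⟩
  have := hf.1
  have hC := (cauchy_iff_seminorm hw).1 hf
  have hlim : ∀ i, ∃ z, Tendsto (fun v : ι →₀ E => v i) f (𝓝 z) := by
    intro i
    have : Cauchy (map (fun v : ι →₀ E => v i) f) := by
      refine (cauchy_iff_seminorm hp).2 fun k ε hε => ?_
      obtain ⟨A, hA, h⟩ := hC (k, fun _ => 1) ε hε
      refine ⟨(fun v : ι →₀ E => v i) '' A, image_mem_map hA, ?_⟩
      rintro _ ⟨v, hv, rfl⟩ _ ⟨w, hw, rfl⟩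
      refine lt_of_le_of_lt ?_ (h v hv w hw)
      simpa using le_weighted p k (fun _ => 1) i (v - w)
    exact CompleteSpace.complete this
  choose l hl using hlim
  have hsum : ∀ (s : Finset ι) (k : κ) (Φ : ι → NNReal) (v : ι →₀ E), Tendsto
      (fun w : ι →₀ E => ∑ i ∈ s, Φ i * p k (v i - w i)) f
      (𝓝 (∑ i ∈ s, Φ i * p k (v i - l i))) := fun s k Φ v =>
    tendsto_finsetSum _ fun i _ => ((hp.continuous_seminorm k).tendsto _ |>.comp
      (tendsto_const_nhds.sub (hl i))).const_mul _
  have hle : ∀ (s : Finset ι) (k : κ) (Φ : ι → NNReal) (v w : ι →₀ E),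
      ∑ i ∈ s, Φ i * p k (v i - w i) ≤ weighted p (k, Φ) (v - w) := by
    intro s k Φ v w
    rw [weighted, sumSeminorm_eq_sum _ _ (Finset.subset_union_right (s₁ := s))]
    exact Finset.sum_le_sum_of_subset_of_nonneg Finset.subset_union_left
      fun i _ _ => apply_nonneg (Φ i • p k) _
  -- On a finite set of indices the Cauchy bound passes to the limit in `w` coordinate by
  -- coordinate; `A` does not depend on `s`, so the bound also controls infinite families.
  have hfin : ∀ (k : κ) (Φ : ι → NNReal) (ε : ℝ), 0 < ε → ∃ A ∈ f, ∀ v ∈ A, ∀ s : Finset ι,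
      ∑ i ∈ s, Φ i * p k (v i - l i) ≤ ε := by
    intro k Φ ε hε
    obtain ⟨A, hA, h⟩ := hC (k, Φ) ε hε
    refine ⟨A, hA, fun v hv s => ?_⟩
    refine le_of_tendsto (hsum s k Φ v) (eventually_of_mem hA fun w hw => ?_)
    exact (hle s k Φ v w).trans (h v hv w hw).le
  have hsupp : {i | l i ≠ 0}.Finite := by
    -- The weight is the reciprocal of `p k₀ (l i)`. An index with `l i ≠ 0` outside the support of
    -- `v` would contribute exactly `1` to a sum that is at most `1/2`, so the limit is supported in
    -- the support of `v`.
    obtain ⟨A, hA, h⟩ := hfin k₀ (fun i => (Real.toNNReal (p k₀ (l i)))⁻¹) (1 / 2) (by norm_num)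
    obtain ⟨v, hv⟩ := nonempty_of_mem hA
    refine v.support.finite_toSet.subset fun i hi => ?_
    rw [Finset.mem_coe, Finsupp.mem_support_iff]
    intro hvi
    have := h v hv {i}
    rw [Finset.sum_singleton, hvi, zero_sub, map_neg_eq_map, NNReal.coe_inv,
      Real.coe_toNNReal _ (apply_nonneg _ _), inv_mul_cancel₀ fun h => hi (h₀ _ h)] at this
    norm_num at this
  let L : ι →₀ E := Finsupp.ofSupportFinite l hsupp
  refine ⟨L, ?_⟩
  change Tendsto id f (𝓝 L)
  rw [hw.tendsto_nhds]
  rintro ⟨k, Φ⟩ ε hε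
  obtain ⟨A, hA, h⟩ := hfin k Φ (ε / 2) (by positivity)
  refine eventually_of_mem hA fun v hv => lt_of_le_of_lt ?_ (half_lt_self hε)
  exact h v hv (v - L).support

/-- Number the indices, and let `Ψ i` be one plus the sum of all `F` over pairs whose numbers do not
exceed that of `i`. For a given pair, the factor with the larger number dominates `F i j` and the
other is at least `1`. -/
theorem exists_weight_mul [Countable ι] (F : ι → ι → NNReal) :
    ∃ Ψ : ι → NNReal, ∀ i j, F i j ≤ Ψ i * Ψ j := by
  classical
  obtain ⟨e, he⟩ := exists_injective_nat ι
  let G : ℕ → ℕ → NNReal := fun a b =>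
    if h : ∃ ij : ι × ι, e ij.1 = a ∧ e ij.2 = b then F h.choose.1 h.choose.2 else 0
  have hG : ∀ i j, G (e i) (e j) = F i j := by
    intro i j
    have h : ∃ ij : ι × ι, e ij.1 = e i ∧ e ij.2 = e j := ⟨(i, j), rfl, rfl⟩
    simp only [G, dif_pos h]
    rw [he h.choose_spec.1, he h.choose_spec.2]
  let H : ℕ → NNReal := fun m => 1 + ∑ a ∈ Finset.range (m + 1), ∑ b ∈ Finset.range (m + 1), G a b
  have h1 : ∀ m, 1 ≤ H m := fun m => le_self_add
  have h2 : ∀ a b m, a ≤ m → b ≤ m → G a b ≤ H m := by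
    intro a b m ha hb
    refine le_add_of_nonneg_of_le zero_le_one ?_
    refine (Finset.single_le_sum (f := fun b => G a b) (fun _ _ => zero_le)
      (Finset.mem_range.2 (Nat.lt_succ_of_le hb))).trans ?_
    exact Finset.single_le_sum (f := fun a => ∑ b ∈ Finset.range (m + 1), G a b)
      (fun _ _ => zero_le) (Finset.mem_range.2 (Nat.lt_succ_of_le ha))
  refine ⟨fun i => H (e i), fun i j => ?_⟩
  rw [← hG]
  rcases le_total (e i) (e j) with h | h
  · exact (h2 _ _ _ h le_rfl).trans (le_mul_of_one_le_left' (h1 _))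
  · exact (h2 _ _ _ le_rfl h).trans (le_mul_of_one_le_right' (h1 _))

/-- The sums over growing squares used in `exists_weight_mul` are monotone on `ℕ`. The extra summand
`c a` makes the diagonal term of the square dominate `c`. -/
theorem exists_monotone_weight (Φ : ℕ × ℕ → NNReal) (c : ℕ → NNReal) :
    ∃ φ : ℕ → NNReal, Monotone φ ∧ (∀ k, c k ≤ φ k) ∧ ∀ k l, Φ (k, l) ≤ φ k * φ l := by
  let G : ℕ → ℕ → NNReal := fun a b => Φ (a, b) + c a
  let H : ℕ → NNReal := fun m => 1 + ∑ a ∈ Finset.range (m + 1), ∑ b ∈ Finset.range (m + 1), G a b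
  have h1 : ∀ m, 1 ≤ H m := fun m => le_self_add
  have h2 : ∀ a b m, a ≤ m → b ≤ m → G a b ≤ H m := by
    intro a b m ha hb
    refine le_add_of_nonneg_of_le zero_le_one ?_
    refine (Finset.single_le_sum (f := fun b => G a b) (fun _ _ => zero_le)
      (Finset.mem_range.2 (Nat.lt_succ_of_le hb))).trans ?_
    exact Finset.single_le_sum (f := fun a => ∑ b ∈ Finset.range (m + 1), G a b)
      (fun _ _ => zero_le) (Finset.mem_range.2 (Nat.lt_succ_of_le ha))
  refine ⟨H, fun m n hmn => ?_, fun k => ?_, fun k l => ?_⟩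
  · have hs : Finset.range (m + 1) ⊆ Finset.range (n + 1) :=
      Finset.range_subset_range.2 (by omega)
    refine add_le_add le_rfl ((Finset.sum_le_sum fun a _ => ?_).trans
      (Finset.sum_le_sum_of_subset hs))
    exact Finset.sum_le_sum_of_subset hs
  · exact le_add_self.trans (h2 k k k le_rfl le_rfl)
  · refine (le_self_add : Φ (k, l) ≤ G k l).trans ?_
    rcases le_total k l with h | h
    · exact (h2 _ _ _ h le_rfl).trans (le_mul_of_one_le_left' (h1 _))
    · exact (h2 _ _ _ le_rfl h).trans (le_mul_of_one_le_right' (h1 _))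

/-- It suffices to bound a bilinear map with one left index fixed, the weight on the right depending
on that index: the resulting double weight `Φ i j` is then dominated by a product `Ψ i * Ψ j`. -/
theorem exists_weighted_bilin_le {G κ : Type*} [AddCommGroup G] [Module ℂ G] [Countable ι]
    (p : κ → Seminorm ℂ E) (k : κ) (q : Seminorm ℂ G) (T : (ι →₀ E) →ₗ[ℂ] (ι →₀ E) →ₗ[ℂ] G)
    (h : ∀ i, ∃ Φ : ι → NNReal, ∀ z w, q (T (Finsupp.single i z) w) ≤ p k z * weighted p (k, Φ) w) :
    ∃ Ψ : ι → NNReal, ∀ v w, q (T v w) ≤ weighted p (k, Ψ) v * weighted p (k, Ψ) w := by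
  choose Φ hΦ using h
  obtain ⟨Ψ, hΨ⟩ := exists_weight_mul Φ
  refine ⟨Ψ, fun v w => ?_⟩
  have h1 : q (T v w) ≤ ∑ i ∈ v.support, p k (v i) * weighted p (k, Φ i) w := by
    have : T v w = ∑ i ∈ v.support, T (Finsupp.single i (v i)) w := by
      conv_lhs => rw [← Finsupp.sum_single v]
      rw [Finsupp.sum, map_sum, LinearMap.sum_apply]
    rw [this]
    exact (seminorm_sum_le q _ _).trans (Finset.sum_le_sum fun i _ => hΦ i _ _)
  refine h1.trans ?_
  rw [weighted_eq_sum p k Ψ v, Finset.sum_mul]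
  refine Finset.sum_le_sum fun i _ => ?_
  rw [mul_comm (Ψ i : ℝ), mul_assoc]
  refine mul_le_mul_of_nonneg_left ?_ (apply_nonneg _ _)
  rw [weighted_eq_sum, weighted_eq_sum, Finset.mul_sum]
  refine Finset.sum_le_sum fun j _ => ?_
  rw [← mul_assoc]
  exact mul_le_mul_of_nonneg_right (by exact_mod_cast hΨ i j) (apply_nonneg _ _)

end Family

/-! ### The algebra `C^∞[0,1]` -/

namespace Smooth

theorem ext_apply (g : Smooth) (t : Set.Icc (0 : ℝ) 1) : g.ext t = g.1 t :=
  Set.IccExtend_val _ _ _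

theorem ext_of_mem (g : Smooth) {t : ℝ} (ht : t ∈ Set.Icc (0 : ℝ) 1) : g.ext t = g.1 ⟨t, ht⟩ :=
  Set.IccExtend_of_mem _ _ ht

theorem hext {g h : Smooth} (H : ∀ t, g.1 t = h.1 t) : g = h := Subtype.ext (funext H)

theorem deriv_zero (g : Smooth) : g.deriv 0 = g.1 := by
  funext t
  rw [deriv, iteratedDerivWithin_zero, ext_apply]

/-- The element of `C^∞[0,1]` given by a function that is smooth on `[0,1]`. -/
def ofFun (f : ℝ → ℂ) (hf : ContDiffOn ℝ ∞ f (Set.Icc 0 1)) : Smooth :=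
  ⟨fun t => f t, hf.congr fun _ ht => Set.IccExtend_of_mem _ _ ht⟩

theorem ofFun_ext (f : ℝ → ℂ) (hf : ContDiffOn ℝ ∞ f (Set.Icc 0 1)) :
    Set.EqOn (ofFun f hf).ext f (Set.Icc 0 1) := fun _ ht => Set.IccExtend_of_mem _ _ ht

theorem continuous_deriv (j : ℕ) (g : Smooth) : Continuous (g.deriv j) :=
  continuousOn_iff_continuous_domRestrict.1 <|
    g.contDiffOn.continuousOn_iteratedDerivWithin (by exact_mod_cast le_top)
      (uniqueDiffOn_Icc zero_lt_one)

theorem continuous_ext (g : Smooth) : Continuous g.ext := by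
  have := continuous_deriv 0 g
  rw [deriv_zero] at this
  exact this.Icc_extend'

theorem contDiffOn_derivWithin (g : Smooth) :
    ContDiffOn ℝ ∞ (derivWithin g.ext (Set.Icc 0 1)) (Set.Icc 0 1) :=
  ((contDiffOn_infty_iff_derivWithin (uniqueDiffOn_Icc zero_lt_one)).1 g.contDiffOn).2

theorem hasDerivWithinAt (g : Smooth) {t : ℝ} (ht : t ∈ Set.Icc (0 : ℝ) 1) :
    HasDerivWithinAt g.ext (derivWithin g.ext (Set.Icc 0 1) t) (Set.Icc 0 1) t :=
  (((contDiffOn_infty_iff_derivWithin (uniqueDiffOn_Icc zero_lt_one)).1 g.contDiffOn).1 t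
    ht).hasDerivWithinAt

/-- Differentiation on `C^∞[0,1]`. -/
def D : Smooth →ₗ[ℂ] Smooth where
  toFun g := ofFun (derivWithin g.ext (Set.Icc 0 1)) g.contDiffOn_derivWithin
  map_add' g h := hext fun t => by
    have := congrFun (deriv_add 1 g h) t
    simp only [deriv, iteratedDerivWithin_one, Pi.add_apply] at this
    exact this
  map_smul' c g := hext fun t => by
    have := congrFun (deriv_smul 1 c g) t
    simp only [deriv, iteratedDerivWithin_one, Pi.smul_apply] at this
    exact this

theorem D_ext (g : Smooth) :
    Set.EqOn g.D.ext (derivWithin g.ext (Set.Icc 0 1)) (Set.Icc 0 1) :=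
  ofFun_ext _ g.contDiffOn_derivWithin

theorem deriv_D (j : ℕ) (g : Smooth) : g.D.deriv j = g.deriv (j + 1) := by
  funext t
  rw [deriv, deriv, iteratedDerivWithin_succ']
  exact iteratedDerivWithin_congr (D_ext g) t.2

theorem hasDerivWithinAt_D (g : Smooth) {t : ℝ} (ht : t ∈ Set.Icc (0 : ℝ) 1) :
    HasDerivWithinAt g.ext (g.D.ext t) (Set.Icc 0 1) t := by
  rw [D_ext g ht]
  exact g.hasDerivWithinAt ht

theorem D_eq_of_hasDerivWithinAt {g h : Smooth}
    (H : ∀ t ∈ Set.Icc (0 : ℝ) 1, HasDerivWithinAt g.ext (h.ext t) (Set.Icc 0 1) t) : g.D = h :=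
  hext fun t => by
    rw [← ext_apply, ← ext_apply, D_ext g t.2,
      (H t t.2).derivWithin (uniqueDiffOn_Icc zero_lt_one _ t.2)]

theorem integral_D (g : Smooth) {t : ℝ} (ht : t ∈ Set.Icc (0 : ℝ) 1) :
    ∫ s in (0 : ℝ)..t, g.D.ext s = g.ext t - g.ext 0 := by
  refine intervalIntegral.integral_eq_sub_of_hasDerivAt_of_le ht.1 g.continuous_ext.continuousOn
    (fun x hx => ?_) (g.D.continuous_ext.intervalIntegrable _ _)
  have hx' : x ∈ Set.Ioo (0 : ℝ) 1 := ⟨hx.1, hx.2.trans_le ht.2⟩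
  exact (g.hasDerivWithinAt_D (Set.Ioo_subset_Icc_self hx')).hasDerivAt (Icc_mem_nhds hx'.1 hx'.2)

theorem hasDerivAt_integral (g : Smooth) (t : ℝ) :
    HasDerivAt (fun u => ∫ s in (0 : ℝ)..u, g.ext s) (g.ext t) t :=
  (g.continuous_ext.integral_hasStrictDerivAt 0 t).hasDerivAt

theorem contDiffOn_integral (g : Smooth) :
    ContDiffOn ℝ ∞ (fun u => ∫ s in (0 : ℝ)..u, g.ext s) (Set.Icc 0 1) := by
  rw [contDiffOn_infty_iff_derivWithin (uniqueDiffOn_Icc zero_lt_one)]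
  refine ⟨fun t _ => (g.hasDerivAt_integral t).differentiableAt.differentiableWithinAt, ?_⟩
  exact g.contDiffOn.congr fun t ht =>
    (g.hasDerivAt_integral t).hasDerivWithinAt.derivWithin (uniqueDiffOn_Icc zero_lt_one _ ht)

/-- Integration from `0` on `C^∞[0,1]`. -/
def J : Smooth →ₗ[ℂ] Smooth where
  toFun g := ofFun _ g.contDiffOn_integral
  map_add' g h := hext fun _ =>
    intervalIntegral.integral_add (g.continuous_ext.intervalIntegrable _ _)
      (h.continuous_ext.intervalIntegrable _ _)
  map_smul' c g := hext fun _ => intervalIntegral.integral_const_mul c g.ext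

theorem J_ext (g : Smooth) {t : ℝ} (ht : t ∈ Set.Icc (0 : ℝ) 1) :
    g.J.ext t = ∫ s in (0 : ℝ)..t, g.ext s := ofFun_ext _ _ ht

theorem D_J (g : Smooth) : g.J.D = g :=
  D_eq_of_hasDerivWithinAt fun t ht =>
    (g.hasDerivAt_integral t).hasDerivWithinAt.congr (fun _ hs => g.J_ext hs) (g.J_ext ht)

/-- The evaluation at a point of `[0,1]`. -/
def eval (t : Set.Icc (0 : ℝ) 1) : Smooth →ₐ[ℂ] ℂ where
  toFun g := g.1 t
  map_one' := rfl
  map_mul' _ _ := rfl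
  map_zero' := rfl
  map_add' _ _ := rfl
  commutes' _ := rfl

theorem J_eval_zero (g : Smooth) : eval 0 g.J = 0 := intervalIntegral.integral_same

theorem J_D (g : Smooth) : g.D.J = g - eval 0 g • 1 := hext fun t => by
  rw [← ext_apply, J_ext _ t.2, integral_D _ t.2, ext_apply]
  change _ - g.ext ((0 : Set.Icc (0 : ℝ) 1) : ℝ) = g.1 t - g.1 0 * 1
  rw [ext_apply, mul_one]

end Smooth

open Smooth

/-! ### The seminorms of `C^∞[0,1]` -/

theorem supDeriv_apply (j : ℕ) (g : Smooth) : supDeriv j g = ⨆ t, ‖g.deriv j t‖ := rfl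

theorem norm_deriv_le (j : ℕ) (g : Smooth) (t : Set.Icc (0 : ℝ) 1) :
    ‖g.deriv j t‖ ≤ supDeriv j g := le_ciSup (g.bddAbove_deriv j) t

theorem supDeriv_le {j : ℕ} {g : Smooth} {c : ℝ} (h : ∀ t, ‖g.deriv j t‖ ≤ c) :
    supDeriv j g ≤ c := ciSup_le h

theorem norm_eval_le (t : Set.Icc (0 : ℝ) 1) (g : Smooth) : ‖eval t g‖ ≤ supDeriv 0 g := by
  have := norm_deriv_le 0 g t
  rwa [deriv_zero] at this

theorem supDeriv_zero_le {g : Smooth} {c : ℝ} (h : ∀ t, ‖g.1 t‖ ≤ c) :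
    supDeriv 0 g ≤ c := supDeriv_le fun t => by rw [deriv_zero]; exact h t

theorem supDeriv_D (j : ℕ) (g : Smooth) : supDeriv j g.D = supDeriv (j + 1) g := by
  rw [supDeriv_apply, supDeriv_apply, deriv_D]

theorem supDeriv_succ_J (j : ℕ) (g : Smooth) : supDeriv (j + 1) g.J = supDeriv j g := by
  rw [← supDeriv_D, D_J]

theorem norm_ext_le (g : Smooth) (t : ℝ) : ‖g.ext t‖ ≤ supDeriv 0 g := norm_eval_le _ _

theorem supDeriv_zero_J_le (g : Smooth) : supDeriv 0 g.J ≤ supDeriv 0 g :=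
  supDeriv_zero_le fun t => by
    rw [← ext_apply, J_ext _ t.2]
    refine (intervalIntegral.norm_integral_le_of_norm_le_const fun s _ => norm_ext_le g s).trans ?_
    rw [sub_zero, abs_of_nonneg t.2.1]
    exact mul_le_of_le_one_right (apply_nonneg _ _) t.2.2

theorem pSeminorm_apply (n : ℕ) (g : Smooth) :
    pSeminorm n g = ∑ j ∈ Finset.range (n + 1), (j.factorial : ℝ)⁻¹ * supDeriv j g := by
  rw [pSeminorm, sum_apply]
  refine Finset.sum_congr rfl fun j _ => ?_
  rw [smul_apply, NNReal.smul_def, smul_eq_mul]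
  simp

theorem pSeminorm_zero (g : Smooth) : pSeminorm 0 g = supDeriv 0 g := by
  simp [pSeminorm_apply]

theorem withSeminorms_pSeminorm : WithSeminorms pSeminorm :=
  seminormUniformSpace_withSeminorms _

theorem pSeminorm_mono {m n : ℕ} (h : m ≤ n) (g : Smooth) : pSeminorm m g ≤ pSeminorm n g := by
  rw [pSeminorm_apply, pSeminorm_apply]
  refine Finset.sum_le_sum_of_subset_of_nonneg (Finset.range_subset_range.2 (by omega))
    fun j _ _ => mul_nonneg (by positivity) (apply_nonneg _ _)

theorem supDeriv_le_pSeminorm (j : ℕ) (g : Smooth) :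
    supDeriv j g ≤ j.factorial * pSeminorm j g := by
  rw [pSeminorm_apply, ← inv_mul_le_iff₀ (by positivity)]
  exact Finset.single_le_sum (f := fun j => (j.factorial : ℝ)⁻¹ * supDeriv j g)
    (fun j _ => mul_nonneg (by positivity) (apply_nonneg _ _)) (Finset.self_mem_range_succ j)

theorem continuous_supDeriv (j : ℕ) : Continuous (supDeriv j) :=
  Seminorm.continuous_of_le (q := (j.factorial : NNReal) • pSeminorm j)
    ((withSeminorms_pSeminorm.continuous_seminorm j).const_smul (j.factorial : NNReal))
    fun g => by
      rw [smul_apply, NNReal.smul_def, smul_eq_mul]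
      exact supDeriv_le_pSeminorm j g

theorem norm_eval_le_pSeminorm (t : Set.Icc (0 : ℝ) 1) (n : ℕ) (g : Smooth) :
    ‖eval t g‖ ≤ pSeminorm n g :=
  (norm_eval_le t g).trans (by rw [← pSeminorm_zero]; exact pSeminorm_mono (Nat.zero_le _) g)

theorem eq_zero_of_pSeminorm {g : Smooth} (h : pSeminorm 0 g = 0) : g = 0 :=
  hext fun t => norm_le_zero_iff.1 ((norm_eval_le_pSeminorm t 0 g).trans h.le)

theorem continuous_to_smooth {E : Type*} [AddCommGroup E] [Module ℂ E]
    [TopologicalSpace E] [IsTopologicalAddGroup E] (f : E →ₗ[ℂ] Smooth)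
    (h : ∀ j, ∃ p : Seminorm ℂ E, Continuous p ∧ ∀ x, supDeriv j (f x) ≤ p x) : Continuous f := by
  choose p hp hle using h
  refine continuous_of_seminorm_le withSeminorms_pSeminorm f fun n =>
    ⟨∑ j ∈ Finset.range (n + 1), ((j.factorial : NNReal)⁻¹) • p j,
      Seminorm.continuous_finsetSum fun j _ => (hp j).const_smul ((j.factorial : NNReal)⁻¹),
      fun x => ?_⟩
  rw [pSeminorm_apply, sum_apply]
  refine Finset.sum_le_sum fun j _ => ?_
  rw [smul_apply, NNReal.smul_def, smul_eq_mul, NNReal.coe_inv, NNReal.coe_natCast]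
  exact mul_le_mul_of_nonneg_left (hle j x) (by positivity)

theorem continuous_D : Continuous D :=
  continuous_to_smooth D fun j => ⟨_, continuous_supDeriv (j + 1), fun g => (supDeriv_D j g).le⟩

theorem continuous_J : Continuous J :=
  continuous_to_smooth J fun j => by
    cases j with
    | zero => exact ⟨_, continuous_supDeriv 0, supDeriv_zero_J_le⟩
    | succ j => exact ⟨_, continuous_supDeriv j, fun g => (supDeriv_succ_J j g).le⟩

/-- Together with `J_D` this makes integration a topological isomorphism of `C^∞[0,1]` onto the
functions vanishing at `0`, the source of the last claim about the closure of `I₁`. -/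
theorem isEmbedding_J : IsEmbedding J :=
  Function.LeftInverse.isEmbedding D_J continuous_D continuous_J

theorem continuous_eval (t : Set.Icc (0 : ℝ) 1) : Continuous (eval t) :=
  continuous_of_seminorm_le (norm_withSeminorms ℂ ℂ) (eval t).toLinearMap
    fun _ => ⟨_, continuous_supDeriv 0, norm_eval_le t⟩

instance : T2Space Smooth :=
  t2Space_of_seminorm withSeminorms_pSeminorm fun _ h => eq_zero_of_pSeminorm (h 0)

theorem supDeriv_mul_le (j : ℕ) (g h : Smooth) :
    supDeriv j (g * h) ≤
      ∑ i ∈ Finset.range (j + 1), j.choose i * supDeriv i g * supDeriv (j - i) h := by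
  refine supDeriv_le fun t => ?_
  have h1 : (g * h).deriv j t = ∑ i ∈ Finset.range (j + 1),
      j.choose i * g.deriv i t * h.deriv (j - i) t :=
    iteratedDerivWithin_mul t.2 (uniqueDiffOn_Icc zero_lt_one)
      ((g.contDiffOn t t.2).of_le (by exact_mod_cast le_top))
      ((h.contDiffOn t t.2).of_le (by exact_mod_cast le_top))
  rw [h1]
  refine (norm_sum_le _ _).trans (Finset.sum_le_sum fun i _ => ?_)
  rw [norm_mul, norm_mul, Complex.norm_natCast]
  gcongr
  · exact norm_deriv_le _ _ _
  · exact norm_deriv_le _ _ _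

/-- The factors `1/j!` absorb the binomial coefficients of the Leibniz rule. What remains is the
part `i + i' ≤ n` of the product of two sums of nonnegative terms. -/
theorem pSeminorm_mul_le (n : ℕ) (g h : Smooth) :
    pSeminorm n (g * h) ≤ pSeminorm n g * pSeminorm n h := by
  let a : ℕ → ℝ := fun j => (j.factorial : ℝ)⁻¹ * supDeriv j g
  let b : ℕ → ℝ := fun j => (j.factorial : ℝ)⁻¹ * supDeriv j h
  have ha : ∀ j, 0 ≤ a j := fun j => mul_nonneg (by positivity) (apply_nonneg _ _)
  have hb : ∀ j, 0 ≤ b j := fun j => mul_nonneg (by positivity) (apply_nonneg _ _)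
  have h1 : pSeminorm n (g * h) ≤
      ∑ j ∈ Finset.range (n + 1), ∑ i ∈ Finset.range (j + 1), a i * b (j - i) := by
    rw [pSeminorm_apply]
    refine Finset.sum_le_sum fun j _ => ?_
    refine (mul_le_mul_of_nonneg_left (supDeriv_mul_le j g h) (by positivity)).trans_eq ?_
    rw [Finset.mul_sum]
    refine Finset.sum_congr rfl fun i hi => ?_
    have hij : i ≤ j := Nat.lt_succ_iff.1 (Finset.mem_range.1 hi)
    rw [Nat.cast_choose ℝ hij]
    simp only [a, b]
    field_simp
  refine h1.trans ?_
  rw [pSeminorm_apply, pSeminorm_apply, Finset.sum_mul_sum, ← Finset.sum_product',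
    Finset.sum_sigma']
  change _ ≤ ∑ x ∈ Finset.range (n + 1) ×ˢ Finset.range (n + 1), a x.1 * b x.2
  -- The map `(j, i) ↦ (i, j - i)` carries the triangle `i ≤ j ≤ n` injectively into the square.
  refine (Finset.sum_image (f := fun x : ℕ × ℕ => a x.1 * b x.2)
    (g := fun x : (_ : ℕ) × ℕ => (x.2, x.1 - x.2)) ?_).symm.trans_le
    (Finset.sum_le_sum_of_subset_of_nonneg ?_ fun x _ _ => mul_nonneg (ha _) (hb _))
  · rintro ⟨j, i⟩ h1 ⟨j', i'⟩ h2 h3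
    simp only [Finset.coe_sigma, Set.mem_sigma_iff, Finset.mem_coe, Finset.mem_range,
      Prod.mk.injEq] at h1 h2 h3
    obtain ⟨rfl, h4⟩ := h3
    have : j = j' := by omega
    rw [this]
  · intro x hx
    obtain ⟨⟨j, i⟩, h1, rfl⟩ := Finset.mem_image.1 hx
    simp only [Finset.mem_sigma, Finset.mem_range, Finset.mem_product] at h1 ⊢
    omega

theorem supDeriv_succ_one (j : ℕ) : supDeriv (j + 1) (1 : Smooth) = 0 := by
  have h : (1 : Smooth).D = 0 := D_eq_of_hasDerivWithinAt fun t ht => by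
    refine (hasDerivWithinAt_const t _ (1 : ℂ)).congr_deriv ?_
    rw [ext_of_mem _ ht]
    rfl
  rw [← supDeriv_D, h, map_zero]

theorem D_t : t.D = 1 := D_eq_of_hasDerivWithinAt fun t ht => by
  rw [ext_of_mem _ ht]
  exact (Complex.ofRealCLM.hasDerivAt (x := t)).hasDerivWithinAt.congr
    (fun s hs => ext_of_mem _ hs) (ext_of_mem _ ht)

theorem pSeminorm_one_le (n : ℕ) : pSeminorm n 1 ≤ 1 := by
  rw [pSeminorm_apply, Finset.sum_range_succ', Finset.sum_eq_zero fun j _ => by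
    rw [supDeriv_succ_one, mul_zero]]
  simp only [Nat.factorial_zero, Nat.cast_one, inv_one, one_mul, zero_add]
  exact supDeriv_zero_le fun t => by
    change ‖(1 : ℂ)‖ ≤ 1
    simp

theorem pSeminorm_t_le (n : ℕ) : pSeminorm n t ≤ 2 := by
  have h0 : supDeriv 0 t ≤ 1 := supDeriv_zero_le fun t => by
    change ‖((t : ℝ) : ℂ)‖ ≤ 1
    rw [Complex.norm_real, Real.norm_eq_abs, abs_of_nonneg t.2.1]
    exact t.2.2
  have h1 : supDeriv 1 t ≤ 1 := by
    rw [← supDeriv_D, D_t, ← pSeminorm_zero]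
    exact pSeminorm_one_le 0
  have h2 : ∀ j, supDeriv (j + 2) t = 0 := fun j => by
    rw [← supDeriv_D, D_t, supDeriv_succ_one]
  -- Passing to `n + 1` guarantees that the terms of order `0` and `1` are both present, even for `n
  -- = 0`; each is at most `1`.
  refine (pSeminorm_mono (Nat.le_succ n) t).trans ?_
  rw [pSeminorm_apply, Finset.sum_range_succ', Finset.sum_range_succ', Finset.sum_eq_zero
    fun j _ => by rw [h2, mul_zero]]
  norm_num
  linarith

/-- The factor `t + k` appears whenever `x'` is moved past `y'^(k+1)`. The product of the bounds `k
+ 2` over `k < l` is `(l+1)!`, which explains the growth demanded of `φ`. -/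
theorem pSeminorm_t_add_le (n k : ℕ) : pSeminorm n (t + (k : ℂ) • 1) ≤ k + 2 := by
  refine (map_add_le_add _ _ _).trans ?_
  rw [map_smul_eq_mul, Complex.norm_natCast]
  nlinarith [pSeminorm_one_le n, pSeminorm_t_le n, Nat.cast_nonneg (α := ℝ) k]

open Smooth

theorem tendsto_smooth {α : Type*} {u : α → Smooth} {f : Filter α} {g : Smooth}
    (h : ∀ j, ∀ ε > 0, ∀ᶠ x in f, supDeriv j (u x - g) ≤ ε) : Tendsto u f (𝓝 g) := by
  have h' : ∀ j, Tendsto (fun x => supDeriv j (u x - g)) f (𝓝 0) := fun j =>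
    (nhds_basis_zero_abs_lt ℝ).tendsto_right_iff.2 fun ε hε => by
      filter_upwards [h j (ε / 2) (half_pos hε)] with x hx
      rw [abs_of_nonneg (apply_nonneg _ _)]
      linarith
  refine (withSeminorms_pSeminorm.tendsto_nhds u g).2 fun n ε hε => ?_
  have : Tendsto (fun x => pSeminorm n (u x - g)) f (𝓝 0) := by
    simp only [pSeminorm_apply]
    have := tendsto_finsetSum (Finset.range (n + 1))
      fun j _ => (h' j).const_mul (j.factorial : ℝ)⁻¹
    simpa using this
  exact this.eventually_lt_const hε

/-! #### Density of the polynomials -/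

theorem eval_polySmooth (s : Set.Icc (0 : ℝ) 1) (p : ℂ[X]) :
    Smooth.eval s (polySmooth p) = p.eval ((s : ℝ) : ℂ) := by
  rw [polySmooth, ← aeval_algHom_apply, ← coe_aeval_eq_eval]
  rfl

theorem polySmooth_C (c : ℂ) : polySmooth (C c) = c • 1 := by
  rw [polySmooth, aeval_C, Algebra.algebraMap_eq_smul_one]

theorem polySmooth_X : polySmooth X = t := aeval_X _

theorem polySmooth_ext (p : ℂ[X]) {s : ℝ} (hs : s ∈ Set.Icc (0 : ℝ) 1) :
    (polySmooth p).ext s = p.eval (s : ℂ) := by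
  rw [ext_of_mem _ hs]
  exact eval_polySmooth ⟨s, hs⟩ p

theorem D_polySmooth (p : ℂ[X]) : D (polySmooth p) = polySmooth (derivative p) :=
  D_eq_of_hasDerivWithinAt fun s hs => by
    rw [polySmooth_ext _ hs]
    exact ((p.hasDerivAt (s : ℂ)).comp_ofReal.hasDerivWithinAt).congr
      (fun _ hs => polySmooth_ext p hs) (polySmooth_ext p hs)

theorem exists_derivative_eq (q : ℂ[X]) : ∃ Q : ℂ[X], derivative Q = q := by
  induction q using Polynomial.induction_on' with
  | add p q hp hq =>
    obtain ⟨P, rfl⟩ := hp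
    obtain ⟨Q, rfl⟩ := hq
    exact ⟨P + Q, map_add _ _ _⟩
  | monomial n a =>
    refine ⟨monomial (n + 1) (a / (n + 1)), ?_⟩
    rw [derivative_monomial]
    have : (n : ℂ) + 1 ≠ 0 := by exact_mod_cast n.succ_ne_zero
    simp [div_mul_cancel₀ a this]

theorem exists_polySmooth_eq_J (q : ℂ[X]) : ∃ Q : ℂ[X], polySmooth Q = J (polySmooth q) := by
  obtain ⟨Q, rfl⟩ := exists_derivative_eq q
  refine ⟨Q - C (Smooth.eval 0 (polySmooth Q)), ?_⟩
  rw [← D_polySmooth, J_D, map_sub, polySmooth_C]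

/-- Weierstrass approximation, within `ε/2`, of the real and of the imaginary part. -/
theorem exists_poly_near_zero (g : Smooth) {ε : ℝ} (hε : 0 < ε) :
    ∃ q : ℂ[X], supDeriv 0 (g - polySmooth q) ≤ ε := by
  obtain ⟨p, hp⟩ := exists_polynomial_near_of_continuousOn 0 1 (fun s => (g.ext s).re)
    (Complex.continuous_re.comp g.continuous_ext).continuousOn (ε / 2) (half_pos hε)
  obtain ⟨r, hr⟩ := exists_polynomial_near_of_continuousOn 0 1 (fun s => (g.ext s).im)
    (Complex.continuous_im.comp g.continuous_ext).continuousOn (ε / 2) (half_pos hε)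
  refine ⟨p.map (algebraMap ℝ ℂ) + C Complex.I * r.map (algebraMap ℝ ℂ),
    supDeriv_zero_le fun s => ?_⟩
  change ‖g.1 s - Smooth.eval s _‖ ≤ ε
  have h1 := (hp s s.2).le
  have h2 := (hr s s.2).le
  rw [abs_sub_comm, ext_apply] at h1 h2
  have h3 : ∀ p : ℝ[X], (p.map (algebraMap ℝ ℂ)).eval ((s : ℝ) : ℂ) = (p.eval (s : ℝ) : ℝ) :=
    fun p => by
      rw [eval_map_algebraMap]
      exact aeval_algebraMap_apply ℂ (s : ℝ) p
  rw [eval_polySmooth, eval_add, eval_mul, eval_C, h3, h3]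
  refine (Complex.norm_le_abs_re_add_abs_im _).trans ?_
  simp only [Complex.sub_re, Complex.add_re, Complex.ofReal_re, Complex.mul_re, Complex.I_re,
    Complex.I_im, Complex.ofReal_im, Complex.sub_im, Complex.add_im, Complex.mul_im, zero_mul,
    one_mul, mul_zero, sub_zero, add_zero, zero_add]
  linarith

/-- Approximate `g'` to order `n` and integrate, restoring the constant `g(0)`. Integration shifts
the orders by one, and on `[0,1]` it does not increase the supremum. -/
theorem exists_poly_near (n : ℕ) : ∀ (g : Smooth) {ε : ℝ}, 0 < ε →
    ∃ q : ℂ[X], ∀ j ≤ n, supDeriv j (g - polySmooth q) ≤ ε := by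
  induction n with
  | zero =>
    intro g ε hε
    obtain ⟨q, hq⟩ := exists_poly_near_zero g hε
    exact ⟨q, fun j hj => by rwa [Nat.le_zero.1 hj]⟩
  | succ n ih =>
    intro g ε hε
    obtain ⟨q, hq⟩ := ih g.D hε
    obtain ⟨Q, hQ⟩ := exists_polySmooth_eq_J q
    refine ⟨Q + C (Smooth.eval 0 g), fun j hj => ?_⟩
    have h : g - polySmooth (Q + C (Smooth.eval 0 g)) = J (g.D - polySmooth q) := by
      rw [map_add, map_sub, hQ, polySmooth_C, J_D]
      abel
    rw [h]
    cases j with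
    | zero => exact (supDeriv_zero_J_le _).trans (hq 0 (Nat.zero_le n))
    | succ j => rw [supDeriv_succ_J]; exact hq j (by omega)

theorem denseRange_polySmooth : DenseRange polySmooth := by
  intro g
  choose q hq using fun n : ℕ =>
    exists_poly_near n g (ε := 1 / ((n : ℝ) + 1)) Nat.one_div_pos_of_nat
  refine mem_closure_of_tendsto (f := fun n => polySmooth (q n)) (b := atTop)
    (tendsto_smooth fun j ε hε => ?_) (Eventually.of_forall fun n => Set.mem_range_self _)
  filter_upwards [eventually_ge_atTop j,
    (tendsto_one_div_add_atTop_nhds_zero_nat (𝕜 := ℝ)).eventually_le_const hε] with n hn hn'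
  rw [map_sub_rev]
  exact (hq n j hn).trans hn'

/-- The continuous map `h ↦ h - h(0)` fixes `g` and sends polynomials to polynomials vanishing at
`0`, so density among all polynomials is enough. -/
theorem mem_closure_polySmooth_vanishing {g : Smooth} (hg : Smooth.eval 0 g = 0) :
    g ∈ closure (polySmooth '' {p | p.eval 0 = 0}) := by
  have := withSeminorms_pSeminorm.continuousSMul
  have hc : Continuous fun h : Smooth => h - Smooth.eval 0 h • (1 : Smooth) :=
    continuous_id.sub ((continuous_eval 0).smul continuous_const)
  have := map_mem_closure hc (denseRange_polySmooth g)
    (t := polySmooth '' {p | p.eval 0 = 0}) ?_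
  · simpa [hg] using this
  · rintro _ ⟨p, rfl⟩
    refine ⟨p - C (p.eval 0), by simp, ?_⟩
    change _ = polySmooth p - Smooth.eval 0 (polySmooth p) • 1
    rw [map_sub, polySmooth_C, eval_polySmooth]
    simp

/-! #### Completeness -/

/-- Treating all members of the sequence at once lets the induction on the order of
differentiability step from `H j` to its derivative `H (j + 1)`. -/
theorem contDiffOn_of_hasDerivWithinAt_seq {H : ℕ → ℝ → ℂ}
    (h : ∀ j, ∀ s ∈ Set.Icc (0 : ℝ) 1, HasDerivWithinAt (H j) (H (j + 1) s) (Set.Icc 0 1) s)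
    (j : ℕ) :
    ContDiffOn ℝ ∞ (H j) (Set.Icc 0 1) := by
  have hd : ∀ j, Set.EqOn (derivWithin (H j) (Set.Icc 0 1)) (H (j + 1)) (Set.Icc 0 1) :=
    fun j s hs => (h j s hs).derivWithin (uniqueDiffOn_Icc zero_lt_one s hs)
  refine contDiffOn_infty.2 fun n => ?_
  induction n generalizing j with
  | zero => exact contDiffOn_zero.2 fun s hs => (h j s hs).continuousWithinAt
  | succ n ih =>
    rw [Nat.cast_add, Nat.cast_one, contDiffOn_succ_iff_derivWithin (uniqueDiffOn_Icc zero_lt_one)]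
    exact ⟨fun s hs => (h j s hs).differentiableWithinAt, fun h => by simp at h,
      (ih (j + 1)).congr (hd j)⟩

theorem iterate_D_apply (j : ℕ) (g : Smooth) : (D^[j] g).1 = g.deriv j := by
  induction j generalizing g with
  | zero => exact (deriv_zero g).symm
  | succ j ih => rw [Function.iterate_succ_apply, ih, deriv_D]

/-- Along a Cauchy filter every derivative converges uniformly on `[0,1]` to a continuous function
`l j`. The fundamental theorem of calculus passes to the limit, so `l (j + 1)` is the derivative of
`l j`; hence `l 0` is smooth and is the limit with all derivatives. -/
instance : CompleteSpace Smooth := by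
  refine ⟨fun {f} hf => ?_⟩
  have := hf.1
  have hC : ∀ j, ∀ ε > 0, ∃ A ∈ f, ∀ g ∈ A, ∀ h ∈ A, supDeriv j (g - h) < ε := fun j ε hε => by
    obtain ⟨A, hA, h⟩ := (cauchy_iff_seminorm withSeminorms_pSeminorm).1 hf j
      ((j.factorial : ℝ)⁻¹ * ε) (by positivity)
    refine ⟨A, hA, fun g hg k hk => (supDeriv_le_pSeminorm j _).trans_lt ?_⟩
    rw [← lt_inv_mul_iff₀ (by positivity)]
    exact h g hg k hk
  have hsub : ∀ j (g h : Smooth), (g - h).deriv j = g.deriv j - h.deriv j := fun j g h => by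
    rw [sub_eq_add_neg, deriv_add, ← neg_one_smul ℂ h, deriv_smul, neg_one_smul, sub_eq_add_neg]
  have hlim : ∀ j s, ∃ z, Tendsto (fun g : Smooth => g.deriv j s) f (𝓝 z) := by
    intro j s
    refine cauchy_map_iff_exists_tendsto.1 (Metric.cauchy_iff.2 ⟨inferInstance, fun ε hε => ?_⟩)
    obtain ⟨A, hA, h⟩ := hC j ε hε
    refine ⟨_, image_mem_map hA, ?_⟩
    rintro _ ⟨g, hg, rfl⟩ _ ⟨k, hk, rfl⟩
    rw [dist_eq_norm]
    refine lt_of_le_of_lt ?_ (h g hg k hk)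
    have := norm_deriv_le j (g - k) s
    rwa [hsub] at this
  choose l hl using hlim
  have hunif : ∀ j, ∀ ε > 0, ∃ A ∈ f, ∀ g ∈ A, ∀ s, ‖g.deriv j s - l j s‖ ≤ ε := by
    intro j ε hε
    obtain ⟨A, hA, h⟩ := hC j ε hε
    refine ⟨A, hA, fun g hg s => ?_⟩
    refine le_of_tendsto (tendsto_const_nhds.sub (hl j s)).norm
      (eventually_of_mem hA fun k hk => ?_)
    have := norm_deriv_le j (g - k) s
    rw [hsub] at this
    exact this.trans (h g hg k hk).le
  have hcont : ∀ j, Continuous (l j) := fun j => by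
    have hu : TendstoUniformly (fun (g : Smooth) s => g.deriv j s) (l j) f := by
      refine Metric.tendstoUniformly_iff.2 fun ε hε => ?_
      obtain ⟨A, hA, h⟩ := hunif j (ε / 2) (half_pos hε)
      refine eventually_of_mem hA fun g hg s => ?_
      rw [dist_comm, dist_eq_norm]
      exact (h g hg s).trans_lt (half_lt_self hε)
    exact hu.continuous (Eventually.of_forall fun g => continuous_deriv j g).frequently
  let H : ℕ → ℝ → ℂ := fun j => Set.IccExtend zero_le_one (l j)
  have hH : ∀ j, Continuous (H j) := fun j => (hcont j).Icc_extend'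
  have hHv : ∀ j (s : Set.Icc (0 : ℝ) 1), H j s = l j s := fun j s => Set.IccExtend_val _ _ _
  -- The integrals of `g^(j+1)` have two limits: by uniform convergence the integral of the limit,
  -- and, being equal to `g^(j)(s) - g^(j)(0)`, also `l j s - l j 0`.
  have hprim : ∀ j, ∀ s ∈ Set.Icc (0 : ℝ) 1, H j s = H j 0 + ∫ u in (0 : ℝ)..s, H (j + 1) u := by
    intro j s hs
    have hg : ∀ g : Smooth, ∫ u in (0 : ℝ)..s, (D^[j + 1] g).ext u =
        g.deriv j ⟨s, hs⟩ - g.deriv j 0 := by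
      intro g
      rw [Function.iterate_succ_apply', integral_D _ hs, ext_of_mem _ hs,
        ext_of_mem _ (by simp : (0 : ℝ) ∈ Set.Icc (0 : ℝ) 1), iterate_D_apply]
      rfl
    have hext : ∀ (g : Smooth) u, (D^[j + 1] g).ext u =
        g.deriv (j + 1) (Set.projIcc 0 1 zero_le_one u) := by
      intro g u
      rw [← iterate_D_apply]
      rfl
    have h1 : Tendsto (fun g : Smooth => ∫ u in (0 : ℝ)..s, (D^[j + 1] g).ext u) f
        (𝓝 (∫ u in (0 : ℝ)..s, H (j + 1) u)) := by
      refine Metric.tendsto_nhds.2 fun ε hε => ?_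
      obtain ⟨A, hA, h⟩ := hunif (j + 1) (ε / 2) (half_pos hε)
      refine eventually_of_mem hA fun g hg => ?_
      rw [dist_eq_norm, ← intervalIntegral.integral_sub
        ((continuous_ext _).intervalIntegrable _ _) ((hH _).intervalIntegrable _ _)]
      refine lt_of_le_of_lt (intervalIntegral.norm_integral_le_of_norm_le_const (C := ε / 2)
        fun u _ => ?_) ?_
      · rw [hext]
        exact h g hg _
      · rw [sub_zero, abs_of_nonneg hs.1]
        nlinarith [hs.2]
    have h2 : Tendsto (fun g : Smooth => ∫ u in (0 : ℝ)..s, (D^[j + 1] g).ext u) f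
        (𝓝 (l j ⟨s, hs⟩ - l j 0)) := by
      simp only [hg]
      exact (hl j _).sub (hl j _)
    have h3 := tendsto_nhds_unique h1 h2
    rw [h3, show H j s = l j ⟨s, hs⟩ from hHv j ⟨s, hs⟩, show H j 0 = l j 0 from hHv j 0]
    ring
  have hderiv : ∀ j, ∀ s ∈ Set.Icc (0 : ℝ) 1,
      HasDerivWithinAt (H j) (H (j + 1) s) (Set.Icc 0 1) s := fun j s hs =>
    ((((hH (j + 1)).integral_hasStrictDerivAt 0 s).hasDerivAt.const_add
      (H j 0)).hasDerivWithinAt).congr (fun u hu => hprim j u hu) (hprim j s hs)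
  have hsm := contDiffOn_of_hasDerivWithinAt_seq hderiv
  let G : ℕ → Smooth := fun j => ofFun (H j) (hsm j)
  have hDG : ∀ j, D (G j) = G (j + 1) := fun j => D_eq_of_hasDerivWithinAt fun s hs => by
    rw [ofFun_ext _ (hsm (j + 1)) hs]
    exact (hderiv j s hs).congr (fun u hu => ofFun_ext _ (hsm j) hu) (ofFun_ext _ (hsm j) hs)
  have hG : ∀ j i, (G i).deriv j = l (i + j) := by
    intro j
    induction j with
    | zero => intro i; rw [deriv_zero]; exact funext fun s => hHv i s
    | succ j ih => intro i; rw [← deriv_D, hDG, ih, add_right_comm, add_assoc]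
  refine ⟨G 0, ?_⟩
  change Tendsto id f (𝓝 (G 0))
  refine tendsto_smooth fun j ε hε => ?_
  obtain ⟨A, hA, h⟩ := hunif j ε hε
  refine eventually_of_mem hA fun g hg => supDeriv_le fun s => ?_
  rw [id, hsub, hG, zero_add]
  exact h g hg s

/-! ### The Weyl algebra -/

/-- Left multiplication by `y` on the coordinates of `∑ λ_{kl} y^k x^l`. -/
def opYW : Module.End ℂ (ℕ × ℕ →₀ ℂ) :=
  Finsupp.lsum ℂ fun kl => Finsupp.lsingle (kl.1 + 1, kl.2)

/-- Left multiplication by `x` on the coordinates of `∑ λ_{kl} y^k x^l`. -/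
def opXW : Module.End ℂ (ℕ × ℕ →₀ ℂ) :=
  Finsupp.lsum ℂ fun kl => (kl.1 : ℂ) • Finsupp.lsingle (kl.1 - 1, kl.2) +
    Finsupp.lsingle (kl.1, kl.2 + 1)

theorem opYW_single (k l : ℕ) (c : ℂ) :
    opYW (Finsupp.single (k, l) c) = Finsupp.single (k + 1, l) c := by
  simp [opYW]

/-- At `k = 0` the truncated index `k - 1` is harmless, because its coefficient is zero. -/
theorem opXW_single (k l : ℕ) (c : ℂ) :
    opXW (Finsupp.single (k, l) c) =
      (k : ℂ) • Finsupp.single (k - 1, l) c + Finsupp.single (k, l + 1) c := by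
  simp [opXW]

theorem opXW_comm : opXW * opYW - opYW * opXW = 1 := by
  refine Finsupp.lhom_ext fun kl c => ?_
  obtain ⟨k, l⟩ := kl
  rw [LinearMap.sub_apply, Module.End.mul_apply, Module.End.mul_apply, opYW_single, opXW_single,
    opXW_single, map_add, map_smul, opYW_single, opYW_single, Module.End.one_apply]
  cases k with
  | zero => simp
  | succ k =>
    simp only [Nat.add_sub_cancel]
    rw [add_sub_add_right_eq_sub, ← sub_smul]
    push_cast
    rw [add_sub_cancel_left, one_smul]

/-- `W` acts on coordinates. -/
def actW : W →ₐ[ℂ] Module.End ℂ (ℕ × ℕ →₀ ℂ) :=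
  RingQuot.liftAlgHom ℂ ⟨FreeAlgebra.lift ℂ ![opXW, opYW], by
    intro a b hab
    cases hab with
    | comm =>
      simp only [map_mul, map_sub, FreeAlgebra.lift_ι_apply, map_one]
      exact opXW_comm⟩

theorem actW_x : actW W.x = opXW := by
  change RingQuot.liftAlgHom ℂ _ (RingQuot.mkAlgHom ℂ WeylRel gx) = _
  rw [RingQuot.liftAlgHom_mkAlgHom_apply, FreeAlgebra.lift_ι_apply]; rfl

theorem actW_y : actW W.y = opYW := by
  change RingQuot.liftAlgHom ℂ _ (RingQuot.mkAlgHom ℂ WeylRel gy) = _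
  rw [RingQuot.liftAlgHom_mkAlgHom_apply, FreeAlgebra.lift_ι_apply]; rfl

/-- `(λ_{kl}) ↦ ∑ λ_{kl} y^k x^l`. -/
def ofCoordW : (ℕ × ℕ →₀ ℂ) →ₗ[ℂ] W :=
  Finsupp.lsum ℂ fun kl => LinearMap.toSpanSingleton ℂ W (W.y ^ kl.1 * W.x ^ kl.2)

theorem ofCoordW_single (k l : ℕ) (c : ℂ) :
    ofCoordW (Finsupp.single (k, l) c) = c • (W.y ^ k * W.x ^ l) := by
  simp [ofCoordW]

theorem x_mul_y_pow (k : ℕ) :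
    W.x * W.y ^ k = (k : ℂ) • W.y ^ (k - 1) + W.y ^ k * W.x := by
  have hxy : W.x * W.y = W.y * W.x + 1 := by rw [← W.x_mul_y]; abel
  induction k with
  | zero => simp
  | succ k ih =>
    rw [pow_succ, ← mul_assoc, ih, add_mul, mul_assoc _ W.x, hxy, mul_add, mul_one, mul_assoc,
      smul_mul_assoc]
    cases k with
    | zero => simp [add_comm]
    | succ k =>
      simp only [Nat.add_sub_cancel, ← pow_succ]
      push_cast
      simp only [add_smul, one_smul]
      abel

theorem ofCoordW_opXW (m : ℕ × ℕ →₀ ℂ) : ofCoordW (opXW m) = W.x * ofCoordW m := by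
  induction m using Finsupp.induction_linear with
  | zero => simp
  | add f g hf hg => rw [map_add, map_add, map_add, mul_add, hf, hg]
  | single kl c =>
    obtain ⟨k, l⟩ := kl
    rw [opXW_single, map_add, map_smul, ofCoordW_single, ofCoordW_single, ofCoordW_single,
      mul_smul_comm, ← mul_assoc, x_mul_y_pow, add_mul, smul_add, smul_mul_assoc, smul_comm,
      pow_succ' W.x, mul_assoc]

theorem ofCoordW_opYW (m : ℕ × ℕ →₀ ℂ) : ofCoordW (opYW m) = W.y * ofCoordW m := by
  induction m using Finsupp.induction_linear with
  | zero => simp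
  | add f g hf hg => rw [map_add, map_add, map_add, mul_add, hf, hg]
  | single kl c =>
    obtain ⟨k, l⟩ := kl
    rw [opYW_single, ofCoordW_single, ofCoordW_single, mul_smul_comm, pow_succ', mul_assoc]

/-- Applied to the basis vector at `(0,0)`, this exhibits `w` as a combination of the monomials `y^k
x^l`, so they span `W`. -/
theorem ofCoordW_actW (w : W) (m : ℕ × ℕ →₀ ℂ) : ofCoordW (actW w m) = w * ofCoordW m := by
  obtain ⟨a, rfl⟩ := RingQuot.mkAlgHom_surjective ℂ WeylRel w
  change ofCoordW (actW (mkW a) m) = mkW a * ofCoordW m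
  induction a using FreeAlgebra.induction generalizing m with
  | grade0 r =>
    rw [AlgHom.commutes, AlgHom.commutes, Module.algebraMap_end_apply, map_smul, Algebra.smul_def]
  | grade1 i =>
    fin_cases i
    · change ofCoordW (actW W.x m) = W.x * _
      rw [actW_x, ofCoordW_opXW]
    · change ofCoordW (actW W.y m) = W.y * _
      rw [actW_y, ofCoordW_opYW]
  | mul a b ha hb => rw [map_mul, map_mul, Module.End.mul_apply, ha, hb, mul_assoc]
  | add a b ha hb => rw [map_add, map_add, LinearMap.add_apply, map_add, ha, hb, add_mul]

/-- Linear independence of the monomials: `y^k x^l` moves the basis vector at `(0,0)` to the one at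
`(k,l)`. -/
theorem actW_ofCoordW (m : ℕ × ℕ →₀ ℂ) : actW (ofCoordW m) (Finsupp.single (0, 0) 1) = m := by
  induction m using Finsupp.induction_linear with
  | zero => simp
  | add f g hf hg => rw [map_add, map_add, LinearMap.add_apply, hf, hg]
  | single kl c =>
    obtain ⟨k, l⟩ := kl
    have hx : ∀ l : ℕ, (opXW ^ l) (Finsupp.single (0, 0) 1) = Finsupp.single (0, l) 1 := by
      intro l
      induction l with
      | zero => simp
      | succ l ih => rw [pow_succ', Module.End.mul_apply, ih, opXW_single]; simp
    have hy : ∀ k l : ℕ, (opYW ^ k) (Finsupp.single (0, l) 1) = Finsupp.single (k, l) 1 := by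
      intro k l
      induction k with
      | zero => simp
      | succ k ih => rw [pow_succ', Module.End.mul_apply, ih, opYW_single]
    rw [ofCoordW_single, map_smul, map_mul, map_pow, map_pow, actW_x, actW_y,
      LinearMap.smul_apply, Module.End.mul_apply, hx, hy, Finsupp.smul_single, smul_eq_mul, mul_one]

/-- The coordinates `(λ_{kl})` of `∑ λ_{kl} y^k x^l`. -/
def coordW : W ≃ₗ[ℂ] (ℕ × ℕ →₀ ℂ) :=
  LinearEquiv.symm
    { ofCoordW with
      invFun := fun w => actW w (Finsupp.single (0, 0) 1)
      left_inv := actW_ofCoordW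
      right_inv := fun w => by
        change ofCoordW (actW w _) = w
        rw [ofCoordW_actW, ofCoordW_single]
        simp }

/-! ### The projection `π` in coordinates -/

theorem coordW_symm_apply (m : ℕ × ℕ →₀ ℂ) : coordW.symm m = ofCoordW m := rfl

theorem coordEquiv_symm_eq (m : Coord) : coordEquiv.symm m = ofCoord m := rfl

theorem piTilde_xT : piTilde xT = W.x := by
  change RingQuot.liftAlgHom ℂ _ (RingQuot.mkAlgHom ℂ WPrimeRel gx) = _
  rw [RingQuot.liftAlgHom_mkAlgHom_apply]; rfl

theorem piTilde_yT : piTilde yT = W.y := by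
  change RingQuot.liftAlgHom ℂ _ (RingQuot.mkAlgHom ℂ WPrimeRel gy) = _
  rw [RingQuot.liftAlgHom_mkAlgHom_apply]; rfl

theorem piTilde_eT : piTilde eT = 1 := by
  rw [eT, map_sub, map_mul, map_mul, piTilde_xT, piTilde_yT, W.x_mul_y]

/-- Since `π(e) = 1`, the factor `z(e)` becomes the scalar `z(1)`. -/
theorem piTilde_ofCoord (m : Coord) :
    piTilde (ofCoord m) = ofCoordW (Finsupp.mapRange.linearMap (leval 1) m) := by
  induction m using Finsupp.induction_linear with
  | zero => simp
  | add f g hf hg => rw [map_add, map_add, map_add, map_add, hf, hg]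
  | single kl z =>
    obtain ⟨k, l⟩ := kl
    have hz : aeval (1 : W) z = algebraMap ℂ W (z.eval 1) := by
      rw [← aeval_algebraMap_apply_eq_algebraMap_eval, map_one]
    rw [ofCoord_single, map_mul, map_mul, map_pow, map_pow, ← aeval_algHom_apply, piTilde_eT,
      piTilde_xT, piTilde_yT, Finsupp.mapRange.linearMap_apply, Finsupp.mapRange_single,
      ofCoordW_single, leval_apply, hz, ← Algebra.commutes, mul_assoc, Algebra.smul_def]

theorem coordW_piTilde (w : WTilde) :
    coordW (piTilde w) = Finsupp.mapRange.linearMap (leval 1) (coordEquiv w) := by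
  obtain ⟨m, rfl⟩ := coordEquiv.symm.surjective w
  rw [coordEquiv_symm_eq, piTilde_ofCoord, ← coordW_symm_apply, LinearEquiv.apply_symm_apply,
    ← coordEquiv_symm_eq, LinearEquiv.apply_symm_apply]

/-! #### The fine topology -/

theorem withSeminorms_W : WithSeminorms fun p : Seminorm ℂ W => p :=
  seminormUniformSpace_withSeminorms _

theorem continuous_seminorm_W (p : Seminorm ℂ W) : Continuous p :=
  withSeminorms_W.continuous_seminorm p

theorem continuous_of_fine {E ι : Type*} [AddCommGroup E] [Module ℂ E] [TopologicalSpace E]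
    {p : ι → Seminorm ℂ E} (hp : WithSeminorms p) (f : W →ₗ[ℂ] E) : Continuous f :=
  continuous_of_seminorm_le hp f fun i => ⟨(p i).comp f, continuous_seminorm_W _, fun _ => le_rfl⟩

/-- The seminorms `∑ λ_{kl} y^k x^l ↦ ∑ Φ(k,l) |λ_{kl}|` on `W`. -/
def weightedW (Φ : ℕ × ℕ → NNReal) : Seminorm ℂ W :=
  (weighted (fun _ : Fin 1 => normSeminorm ℂ ℂ) (0, Φ)).comp coordW.toLinearMap

/-- The triangle inequality on the basis, with the values of `p ∘ f` on basis vectors as weights.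
Hence the weighted `ℓ¹` seminorms already define the fine topology. -/
theorem exists_le_weightedW {E : Type*} [AddCommGroup E] [Module ℂ E] (p : Seminorm ℂ E)
    (f : (ℕ × ℕ →₀ ℂ) →ₗ[ℂ] E) : ∃ Φ : ℕ × ℕ → NNReal, ∀ v, p (f v) ≤
      weighted (fun _ : Fin 1 => normSeminorm ℂ ℂ) (0, Φ) v := by
  refine ⟨fun i => Real.toNNReal (p (f (Finsupp.single i 1))), fun v => ?_⟩
  refine seminorm_le_sumSeminorm (p.comp f) _ (fun i z => ?_) v
  have : Finsupp.single i z = z • Finsupp.single i (1 : ℂ) := by simp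
  rw [Seminorm.comp_apply, this, map_smul, map_smul_eq_mul, smul_apply, NNReal.smul_def,
    Real.coe_toNNReal _ (apply_nonneg _ _), smul_eq_mul, mul_comm]
  rfl

/-- The monomial basis is countable, so the values of `p` on products of two basis elements are
dominated by a product weight `Ψ i * Ψ j`. -/
instance : ContinuousMul W := by
  refine continuousMul_of_seminorm_le withSeminorms_W fun p => ?_
  let T : (ℕ × ℕ →₀ ℂ) →ₗ[ℂ] (ℕ × ℕ →₀ ℂ) →ₗ[ℂ] W :=
    (LinearMap.mul ℂ W).compl₁₂ coordW.symm.toLinearMap coordW.symm.toLinearMap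
  obtain ⟨Ψ, hΨ⟩ := exists_weighted_bilin_le (fun _ : Fin 1 => normSeminorm ℂ ℂ) 0 p T fun i => by
    obtain ⟨Φ, hΦ⟩ := exists_le_weightedW p (T (Finsupp.single i 1))
    refine ⟨Φ, fun z w => ?_⟩
    have : Finsupp.single i z = z • Finsupp.single i (1 : ℂ) := by simp
    rw [this, map_smul, LinearMap.smul_apply, map_smul_eq_mul]
    exact mul_le_mul_of_nonneg_left (hΦ w) (norm_nonneg z)
  refine ⟨weightedW Ψ, continuous_seminorm_W _, fun a b => ?_⟩
  have := hΨ (coordW a) (coordW b)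
  simp only [T, LinearMap.compl₁₂_apply, LinearEquiv.coe_coe, LinearEquiv.symm_apply_apply,
    LinearMap.mul_apply'] at this
  exact this

/-- In monomial coordinates the fine topology is the direct sum topology with entries in `ℂ`; the
one-element index type `Fin 1` stands for the single norm of `ℂ`. -/
instance : CompleteSpace W := by
  let _ : UniformSpace (ℕ × ℕ →₀ ℂ) :=
    seminormUniformSpace (weighted fun _ : Fin 1 => normSeminorm ℂ ℂ)
  have : IsUniformAddGroup (ℕ × ℕ →₀ ℂ) := seminormUniformSpace_isUniformAddGroup _
  have hw : WithSeminorms (weighted fun _ : Fin 1 => normSeminorm ℂ ℂ :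
      Fin 1 × (ℕ × ℕ → NNReal) → Seminorm ℂ (ℕ × ℕ →₀ ℂ)) :=
    seminormUniformSpace_withSeminorms _
  have : CompleteSpace (ℕ × ℕ →₀ ℂ) :=
    completeSpace_weighted (p := fun _ : Fin 1 => normSeminorm ℂ ℂ) (norm_withSeminorms ℂ ℂ) 0
      fun z h => norm_eq_zero.1 h
  let e : W ≃L[ℂ] (ℕ × ℕ →₀ ℂ) :=
    { coordW with
      continuous_toFun := continuous_of_fine hw coordW.toLinearMap
      continuous_invFun := by
        refine continuous_of_seminorm_le withSeminorms_W coordW.symm.toLinearMap fun p => ?_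
        obtain ⟨Φ, hΦ⟩ := exists_le_weightedW p coordW.symm.toLinearMap
        exact ⟨_, hw.continuous_seminorm (0, Φ), hΦ⟩ }
  exact (completeSpace_congr e.isUniformEmbedding (e := e.toEquiv)).2 inferInstance

instance : T2Space W := by
  refine t2Space_of_seminorm withSeminorms_W fun w h => coordW.map_eq_zero_iff.1 ?_
  refine Finsupp.ext fun i => norm_le_zero_iff.1 ?_
  have := le_weighted (fun _ : Fin 1 => normSeminorm ℂ ℂ) 0 (fun _ => 1) i (coordW w)
  have h0 : weighted (fun _ : Fin 1 => normSeminorm ℂ ℂ) (0, fun _ => 1) (coordW w) = 0 :=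
    h (weightedW fun _ => 1)
  rw [h0] at this
  simpa using this

theorem locallyConvexAlgebra_of {A ι : Type*} [NonUnitalRing A] [Module ℂ A] [UniformSpace A]
    [IsScalarTower ℂ A A] [SMulCommClass ℂ A A] [IsUniformAddGroup A] [ContinuousMul A]
    [CompleteSpace A] [T2Space A] {p : ι → Seminorm ℂ A} (hp : WithSeminorms p) :
    LocallyConvexAlgebra A :=
  have := hp.continuousSMul
  have := hp.toPolynormableSpace
  { }

instance : LocallyConvexAlgebra W := locallyConvexAlgebra_of withSeminorms_W

/-! ### Families of smooth functions

The completion of `W'` consists of finite sums `∑ y'^k z_{kl}(e) x'^l` with `z_{kl} ∈ C^∞[0,1]`. -/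

/-- Finite families `(z_{kl})` of smooth functions. -/
abbrev SFam : Type := ℕ × ℕ →₀ Smooth

/-- The evaluation at `1`. -/
abbrev eval₁ : Smooth →ₗ[ℂ] ℂ := (Smooth.eval 1).toLinearMap

/-- Left multiplication by `y'` on families of smooth functions. -/
def opYS : Module.End ℂ SFam :=
  Finsupp.lsum ℂ fun kl => Finsupp.lsingle (kl.1 + 1, kl.2)

/-- Left multiplication by `x'` on families of smooth functions. -/
def opXS : Module.End ℂ SFam :=
  Finsupp.lsum ℂ fun kl =>
    match kl with
    | (0, l) => Finsupp.lsingle (0, l + 1) ∘ₗ eval₁.smulRight 1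
    | (k + 1, l) => Finsupp.lsingle (k, l) ∘ₗ LinearMap.mulLeft ℂ (Smooth.t + (k : ℂ) • 1) +
        Finsupp.lsingle (k + 1, l + 1) ∘ₗ eval₁.smulRight 1

theorem opYS_single (k l : ℕ) (z : Smooth) :
    opYS (Finsupp.single (k, l) z) = Finsupp.single (k + 1, l) z := by
  simp [opYS]

theorem opXS_single_zero (l : ℕ) (z : Smooth) :
    opXS (Finsupp.single (0, l) z) = Finsupp.single (0, l + 1) (eval₁ z • 1) := by
  simp [opXS]

theorem opXS_single_succ (k l : ℕ) (z : Smooth) :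
    opXS (Finsupp.single (k + 1, l) z) =
      Finsupp.single (k, l) ((Smooth.t + (k : ℂ) • 1) * z) +
        Finsupp.single (k + 1, l + 1) (eval₁ z • 1) := by
  simp [opXS]

/-- Left multiplication by `a(e)` on families of smooth functions, for smooth `a`. -/
def opES : Smooth →ₗ[ℂ] Module.End ℂ SFam :=
  (Finsupp.lsum ℂ fun kl =>
    match kl with
    | (0, l) => (LinearMap.mul ℂ Smooth).flip.compr₂ (Finsupp.lsingle (0, l))
    | (k + 1, l) => (LinearMap.lsmul ℂ SFam ∘ₗ eval₁).flip ∘ₗ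
        Finsupp.lsingle (k + 1, l) : SFam →ₗ[ℂ] Smooth →ₗ[ℂ] SFam).flip

theorem opES_single_zero (a : Smooth) (l : ℕ) (z : Smooth) :
    opES a (Finsupp.single (0, l) z) = Finsupp.single (0, l) (a * z) := by
  rw [mul_comm]
  simp [opES]

theorem opES_single_succ (a : Smooth) (k l : ℕ) (z : Smooth) :
    opES a (Finsupp.single (k + 1, l) z) = eval₁ a • Finsupp.single (k + 1, l) z := by
  simp [opES]

/-- The product of families of smooth functions. -/
def mulS : SFam →ₗ[ℂ] SFam →ₗ[ℂ] SFam :=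
  Finsupp.lsum ℂ fun kl =>
    LinearMap.mulLeftRight ℂ (opYS ^ kl.1, opXS ^ kl.2) ∘ₗ opES

theorem mulS_single (k l : ℕ) (a : Smooth) (w : SFam) :
    mulS (Finsupp.single (k, l) a) w = (opYS ^ k) (opES a ((opXS ^ l) w)) := by
  rw [mulS, Finsupp.lsum_single]
  rfl

/-- The inclusion of families of polynomials. -/
def polyFam : Coord →ₗ[ℂ] SFam := Finsupp.mapRange.linearMap polySmooth.toLinearMap

theorem polyFam_single (i : ℕ × ℕ) (z : ℂ[X]) :
    polyFam (Finsupp.single i z) = Finsupp.single i (polySmooth z) := by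
  simp [polyFam]

theorem eval₁_polySmooth (z : ℂ[X]) : eval₁ (polySmooth z) = z.eval 1 := by
  have := eval_polySmooth 1 z
  simpa using this

theorem polyFam_opY (v : Coord) : polyFam (opY v) = opYS (polyFam v) := by
  induction v using Finsupp.induction_linear with
  | zero => simp
  | add f g hf hg => simp only [map_add, hf, hg]
  | single kl z => rw [opY_single, polyFam_single, polyFam_single, opYS_single]

theorem polyFam_opX (v : Coord) : polyFam (opX v) = opXS (polyFam v) := by
  induction v using Finsupp.induction_linear with
  | zero => simp
  | add f g hf hg => simp only [map_add, hf, hg]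
  | single kl z =>
    obtain ⟨k, l⟩ := kl
    cases k with
    | zero =>
      rw [opX_single_zero, polyFam_single, polyFam_single, opXS_single_zero, polySmooth_C,
        eval₁_polySmooth]
    | succ k =>
      rw [opX_single_succ, map_add, polyFam_single, polyFam_single, polyFam_single,
        opXS_single_succ, polySmooth_C, eval₁_polySmooth, map_mul, map_add, polySmooth_C,
        polySmooth_X]

theorem act_aeval_single_zero (a : ℂ[X]) (l : ℕ) (z : ℂ[X]) :
    act (aeval eT a) (Finsupp.single (0, l) z) = Finsupp.single (0, l) (a * z) := by
  rw [← aeval_algHom_apply, act_eT]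
  induction a using Polynomial.induction_on with
  | C c => simp [Algebra.algebraMap_eq_smul_one, smul_eq_C_mul]
  | add p q hp hq => rw [map_add, LinearMap.add_apply, hp, hq, add_mul, Finsupp.single_add]
  | monomial n c h =>
    rw [pow_succ, ← mul_assoc, mul_comm _ X, map_mul, aeval_X, Module.End.mul_apply, h,
      opE_single_zero, mul_assoc X]

/-- From `e y' = y'`, the element `e` acts as the identity on terms with at least one `y'` on the
left, so `a(e)` acts as the scalar `a(1)`. -/
theorem act_aeval_single_succ (a : ℂ[X]) (k l : ℕ) (z : ℂ[X]) :
    act (aeval eT a) (Finsupp.single (k + 1, l) z) =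
      a.eval 1 • Finsupp.single (k + 1, l) z := by
  rw [← aeval_algHom_apply, act_eT]
  induction a using Polynomial.induction_on with
  | C c => simp [Algebra.algebraMap_eq_smul_one, smul_eq_C_mul]
  | add p q hp hq => rw [map_add, LinearMap.add_apply, hp, hq, eval_add, add_smul]
  | monomial n c h =>
    rw [pow_succ, ← mul_assoc, mul_comm _ X, map_mul, aeval_X, Module.End.mul_apply, h, map_smul,
      opE_single_succ]
    simp

theorem polyFam_act_aeval (a : ℂ[X]) (v : Coord) :
    polyFam (act (aeval eT a) v) = opES (polySmooth a) (polyFam v) := by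
  induction v using Finsupp.induction_linear with
  | zero => simp
  | add f g hf hg => simp only [map_add, hf, hg]
  | single kl z =>
    obtain ⟨k, l⟩ := kl
    cases k with
    | zero =>
      rw [act_aeval_single_zero, polyFam_single, polyFam_single, opES_single_zero, map_mul]
    | succ k =>
      rw [act_aeval_single_succ, map_smul, polyFam_single, opES_single_succ, eval₁_polySmooth]

/-- The product `mulS` is built from the operators that extend `opX`, `opY` and the action of `a(e)`
to smooth coefficients; this shows that it really extends the product of `W'`. -/
theorem polyFam_act (u v : Coord) :
    polyFam (act (ofCoord u) v) = mulS (polyFam u) (polyFam v) := by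
  induction u using Finsupp.induction_linear with
  | zero => simp
  | add f g hf hg => simp only [map_add, LinearMap.add_apply, hf, hg]
  | single kl z =>
    obtain ⟨k, l⟩ := kl
    have hy : ∀ (k : ℕ) (v : Coord), polyFam ((opY ^ k) v) = (opYS ^ k) (polyFam v) := by
      intro k
      induction k with
      | zero => simp
      | succ k ih => intro v; rw [pow_succ, pow_succ, Module.End.mul_apply, ih, polyFam_opY]; rfl
    have hx : ∀ (k : ℕ) (v : Coord), polyFam ((opX ^ k) v) = (opXS ^ k) (polyFam v) := by
      intro k
      induction k with
      | zero => simp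
      | succ k ih => intro v; rw [pow_succ, pow_succ, Module.End.mul_apply, ih, polyFam_opX]; rfl
    rw [ofCoord_single, map_mul, map_mul, map_pow, map_pow, act_xT, act_yT, Module.End.mul_apply,
      Module.End.mul_apply, hy, polyFam_act_aeval, hx, polyFam_single, mulS_single]

/-! #### Bounds -/

theorem pSeminorm_eval₁_smul_le (n : ℕ) (z : Smooth) :
    pSeminorm n (eval₁ z • (1 : Smooth)) ≤ pSeminorm n z := by
  rw [map_smul_eq_mul]
  exact (mul_le_of_le_one_right (norm_nonneg _) (pSeminorm_one_le n)).trans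
    (norm_eval_le_pSeminorm 1 n z)

/-- Continuity of an operator for the seminorms `v ↦ ∑ Φ(k,l) p_n(v_{kl})`, with fixed `n`. -/
def IsTame (T : Module.End ℂ SFam) : Prop :=
  ∀ n Φ, ∃ Ψ, ∀ v, weighted pSeminorm (n, Φ) (T v) ≤ weighted pSeminorm (n, Ψ) v

theorem IsTame.of_single {T : Module.End ℂ SFam}
    (h : ∀ n Φ i, ∃ C : NNReal, ∀ z,
      weighted pSeminorm (n, Φ) (T (Finsupp.single i z)) ≤ C * pSeminorm n z) : IsTame T := by
  intro n Φ
  choose C hC using h n Φ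
  exact ⟨C, fun v => seminorm_le_sumSeminorm ((weighted pSeminorm (n, Φ)).comp T) _ hC v⟩

theorem IsTame.pow {T : Module.End ℂ SFam} (h : IsTame T) (k : ℕ) : IsTame (T ^ k) := by
  induction k with
  | zero => exact fun n Φ => ⟨Φ, fun v => le_rfl⟩
  | succ k ih =>
    intro n Φ
    obtain ⟨Ψ, hΨ⟩ := ih n Φ
    obtain ⟨Ξ, hΞ⟩ := h n Ψ
    exact ⟨Ξ, fun v => by
      rw [pow_succ, Module.End.mul_apply]
      exact (hΨ _).trans (hΞ _)⟩

theorem isTame_opYS : IsTame opYS := by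
  refine IsTame.of_single fun n Φ i => ⟨Φ (i.1 + 1, i.2), fun z => ?_⟩
  rw [opYS_single, weighted_single]

theorem isTame_opXS : IsTame opXS := by
  refine IsTame.of_single fun n Φ i => ?_
  obtain ⟨k, l⟩ := i
  cases k with
  | zero =>
    refine ⟨Φ (0, l + 1), fun z => ?_⟩
    rw [opXS_single_zero, weighted_single]
    exact mul_le_mul_of_nonneg_left (pSeminorm_eval₁_smul_le n z) (NNReal.coe_nonneg _)
  | succ k =>
    -- The first term pays for multiplication by `t + k`, the second for the scalar `z(1)`.
    refine ⟨Φ (k, l) * (k + 2) + Φ (k + 1, l + 1), fun z => ?_⟩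
    rw [opXS_single_succ]
    refine (map_add_le_add _ _ _).trans ?_
    rw [weighted_single, weighted_single]
    rw [NNReal.coe_add, NNReal.coe_mul, add_mul _ (Φ (k + 1, l + 1) : ℝ), mul_assoc,
      NNReal.coe_add, NNReal.coe_natCast,
      NNReal.coe_ofNat]
    refine add_le_add (mul_le_mul_of_nonneg_left ?_ (NNReal.coe_nonneg _))
      (mul_le_mul_of_nonneg_left (pSeminorm_eval₁_smul_le n z) (NNReal.coe_nonneg _))
    exact (pSeminorm_mul_le n _ _).trans
      (mul_le_mul_of_nonneg_right (pSeminorm_t_add_le n k) (apply_nonneg _ _))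

/-- Depending on `k`, the operator multiplies an entry by `a` or by the scalar `a(1)`; both cost at
most `p_n(a)`. No change of weight or of `n` occurs, which gives the form needed in
`exists_weighted_bilin_le`. -/
theorem weighted_opES_le (n : ℕ) (Φ : ℕ × ℕ → NNReal) (a : Smooth) (v : SFam) :
    weighted pSeminorm (n, Φ) (opES a v) ≤ pSeminorm n a * weighted pSeminorm (n, Φ) v := by
  have h := seminorm_le_sumSeminorm ((weighted pSeminorm (n, Φ)).comp (opES a))
    (fun i => Real.toNNReal (pSeminorm n a) • (Φ i • pSeminorm n)) (fun i z => ?_) v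
  · refine h.trans_eq ?_
    rw [weighted_eq_sum, Finset.mul_sum, sumSeminorm_eq_sum _ _ le_rfl]
    refine Finset.sum_congr rfl fun i _ => ?_
    simp only [smul_apply, NNReal.smul_def, smul_eq_mul, Real.coe_toNNReal _
      (apply_nonneg (pSeminorm n) a)]
  · simp only [smul_apply, NNReal.smul_def, smul_eq_mul, Real.coe_toNNReal _
      (apply_nonneg (pSeminorm n) a), Seminorm.comp_apply]
    obtain ⟨k, l⟩ := i
    rw [mul_left_comm]
    cases k with
    | zero =>
      rw [opES_single_zero, weighted_single]
      exact mul_le_mul_of_nonneg_left (pSeminorm_mul_le n a z) (NNReal.coe_nonneg _)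
    | succ k =>
      rw [opES_single_succ, map_smul_eq_mul, weighted_single, mul_left_comm]
      exact mul_le_mul_of_nonneg_left (mul_le_mul_of_nonneg_right (norm_eval_le_pSeminorm 1 n a)
        (apply_nonneg _ _)) (NNReal.coe_nonneg _)

theorem exists_weighted_mulS_le (n : ℕ) (Φ : ℕ × ℕ → NNReal) :
    ∃ Ψ : ℕ × ℕ → NNReal, ∀ v w, weighted pSeminorm (n, Φ) (mulS v w) ≤
      weighted pSeminorm (n, Ψ) v * weighted pSeminorm (n, Ψ) w := by
  refine exists_weighted_bilin_le pSeminorm n _ mulS fun i => ?_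
  obtain ⟨Ψ, hΨ⟩ := isTame_opYS.pow i.1 n Φ
  obtain ⟨Ξ, hΞ⟩ := isTame_opXS.pow i.2 n Ψ
  refine ⟨Ξ, fun z w => ?_⟩
  rw [mulS_single]
  exact (hΨ _).trans ((weighted_opES_le n Ψ z _).trans
    (mul_le_mul_of_nonneg_left (hΞ w) (apply_nonneg _ _)))

/-! #### The locally convex algebra of families of smooth functions -/

/-- The algebra of finite sums `∑ y'^k z_{kl}(e) x'^l` with `z_{kl} ∈ C^∞[0,1]`. -/
def SCoord : Type := SFam

instance : AddCommGroup SCoord := inferInstanceAs (AddCommGroup SFam)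

instance : Module ℂ SCoord := inferInstanceAs (Module ℂ SFam)

instance : UniformSpace SCoord := seminormUniformSpace (E := SFam) (weighted pSeminorm)

instance : IsUniformAddGroup SCoord := seminormUniformSpace_isUniformAddGroup (E := SFam) _

theorem withSeminorms_SCoord :
    WithSeminorms (E := SCoord) (weighted pSeminorm :
      ℕ × (ℕ × ℕ → NNReal) → Seminorm ℂ SFam) :=
  seminormUniformSpace_withSeminorms (E := SFam) _

instance : NonUnitalNonAssocRing SCoord where
  mul v w := mulS v w
  left_distrib v w w' := map_add (mulS v) w w'
  right_distrib v v' w := LinearMap.congr_fun (map_add mulS v v') w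
  zero_mul w := LinearMap.congr_fun (map_zero mulS) w
  mul_zero v := map_zero (mulS v)

theorem SCoord.mul_def (v w : SCoord) : v * w = mulS v w := rfl

instance : IsScalarTower ℂ SCoord SCoord :=
  ⟨fun c v w => LinearMap.congr_fun (map_smul mulS c v) w⟩

instance : SMulCommClass ℂ SCoord SCoord :=
  ⟨fun c v w => (map_smul (mulS v) c w).symm⟩

instance : ContinuousMul SCoord :=
  continuousMul_of_seminorm_le withSeminorms_SCoord fun i => by
    obtain ⟨Ψ, hΨ⟩ := exists_weighted_mulS_le i.1 i.2
    exact ⟨_, withSeminorms_SCoord.continuous_seminorm (i.1, Ψ), hΨ⟩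

instance : CompleteSpace SCoord :=
  completeSpace_weighted withSeminorms_pSeminorm 0 fun _ => eq_zero_of_pSeminorm

instance : ContinuousSMul ℂ SCoord := withSeminorms_SCoord.continuousSMul

/-- The coefficient `z_{kl}`. -/
def coeffS (i : ℕ × ℕ) : SCoord →ₗ[ℂ] Smooth := Finsupp.lapply i

/-- The family with a single entry. -/
def singleS (i : ℕ × ℕ) : Smooth →ₗ[ℂ] SCoord := Finsupp.lsingle i

theorem coeffS_singleS (i : ℕ × ℕ) (z : Smooth) : coeffS i (singleS i z) = z :=
  Finsupp.single_eq_same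

theorem continuous_coeffS (i : ℕ × ℕ) : Continuous (coeffS i) :=
  continuous_of_seminorm_le withSeminorms_pSeminorm _ fun n =>
    ⟨_, withSeminorms_SCoord.continuous_seminorm (n, fun _ => 1), fun v => by
      have := le_weighted pSeminorm n (fun _ => 1) i v
      rwa [NNReal.coe_one, one_mul] at this⟩

theorem continuous_singleS (i : ℕ × ℕ) : Continuous (singleS i) :=
  continuous_of_seminorm_le withSeminorms_SCoord _ fun j =>
    ⟨j.2 i • pSeminorm j.1, (withSeminorms_pSeminorm.continuous_seminorm j.1).const_smul (j.2 i),
      fun z => (weighted_single pSeminorm j.1 j.2 i z).le⟩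

theorem isEmbedding_singleS (i : ℕ × ℕ) : IsEmbedding (singleS i) :=
  Function.LeftInverse.isEmbedding (coeffS_singleS i) (continuous_coeffS i) (continuous_singleS i)

instance : T2Space SCoord :=
  t2Space_of_seminorm withSeminorms_SCoord fun v h => Finsupp.ext fun i =>
    eq_zero_of_pSeminorm <| by
      have := (le_weighted pSeminorm 0 (fun _ => 1) i v).trans_eq (h (0, fun _ => 1))
      rw [NNReal.coe_one, one_mul] at this
      exact le_antisymm this (apply_nonneg _ _)

/-- The inclusion of `WTilde`. -/
def inclS : WTilde →ₗ[ℂ] SCoord := polyFam ∘ₗ coordEquiv.toLinearMap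

theorem inclS_apply (w : WTilde) : inclS w = polyFam (coordEquiv w) := rfl

/-! ### Multiplicativity, injectivity and density of the inclusion -/

theorem coordEquiv_mul (a b : WTilde) : coordEquiv (a * b) = act a (coordEquiv b) := by
  change act (a * b) _ = act a (act b _)
  rw [map_mul, Module.End.mul_apply]

theorem inclS_mul (a b : WTilde) : inclS (a * b) = inclS a * inclS b := by
  obtain ⟨u, rfl⟩ := coordEquiv.symm.surjective a
  rw [inclS_apply, coordEquiv_mul, coordEquiv_symm_eq, polyFam_act, SCoord.mul_def, inclS_apply,
    inclS_apply, ← coordEquiv_symm_eq, LinearEquiv.apply_symm_apply]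

theorem inclS_ofCoord (v : Coord) : inclS (ofCoord v) = polyFam v := by
  rw [inclS_apply, ← coordEquiv_symm_eq, LinearEquiv.apply_symm_apply]

theorem polySmooth_injective : Function.Injective polySmooth := by
  refine (injective_iff_map_eq_zero polySmooth).2 fun p hp => ?_
  refine Polynomial.eq_zero_of_infinite_isRoot p ?_
  refine (((Set.Icc_infinite (zero_lt_one' ℝ)).image Complex.ofReal_injective.injOn)).mono ?_
  rintro _ ⟨s, hs, rfl⟩
  have := eval_polySmooth ⟨s, hs⟩ p
  rw [hp, map_zero] at this
  exact this.symm

theorem inclS_injective : Function.Injective inclS := fun _ _ h =>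
  coordEquiv.injective (Finsupp.mapRange_injective _ (map_zero _) polySmooth_injective h)

theorem denseRange_inclS : DenseRange inclS := by
  intro v
  let S : Submodule ℂ SCoord := (LinearMap.range inclS).topologicalClosure
  change v ∈ S
  have h : ∀ i z, singleS i z ∈ S := fun i z => by
    refine map_mem_closure (continuous_singleS i) (denseRange_polySmooth z) ?_
    rintro _ ⟨p, rfl⟩
    exact ⟨ofCoord (Finsupp.single i p), by rw [inclS_ofCoord, polyFam_single]; rfl⟩
  rw [← Finsupp.sum_single (show SFam from v)]
  exact S.sum_mem fun i _ => h i _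

/-- Associativity is a closed condition and holds on the dense image of the associative algebra
`WTilde`. -/
instance : NonUnitalRing SCoord where
  mul_assoc a b c := by
    refine DenseRange.induction_on₃ denseRange_inclS (p := fun a b c => a * b * c = a * (b * c))
      (isClosed_eq (by fun_prop) (by fun_prop)) (fun _ _ _ => ?_) a b c
    rw [← inclS_mul, ← inclS_mul, ← inclS_mul, ← inclS_mul, mul_assoc]

instance : LocallyConvexAlgebra SCoord := locallyConvexAlgebra_of withSeminorms_SCoord

/-! #### The seminorms `α_{φ,ψ}` on families of smooth functions -/

/-- The component in the closure of `I` of `z(e)`: `z(t) - z(1) t`. -/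
def partIS : Smooth →ₗ[ℂ] Smooth := LinearMap.id - eval₁.smulRight Smooth.t

theorem partIS_apply (z : Smooth) : partIS z = z - eval₁ z • Smooth.t := rfl

theorem partIS_polySmooth (z : ℂ[X]) : partIS (polySmooth z) = polySmooth (partI z) := by
  have : partI z = z - C (z.eval 1) * X := rfl
  rw [partIS_apply, eval₁_polySmooth, this, map_sub, map_mul, polySmooth_C, polySmooth_X,
    smul_mul_assoc, one_mul]

/-- The seminorm `z ↦ φ(k) φ(l) p_n(z(t) - z(1) t) + ψ(k) ψ(l) |z(1)|`. -/
def alphaTerm (i : Param) (kl : ℕ × ℕ) : Seminorm ℂ Smooth :=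
  (i.φ kl.1 * i.φ kl.2) • (pSeminorm i.n).comp partIS +
    (i.ψ kl.1 * i.ψ kl.2) • (normSeminorm ℂ ℂ).comp eval₁

theorem alphaTerm_apply (i : Param) (kl : ℕ × ℕ) (z : Smooth) :
    alphaTerm i kl z = i.φ kl.1 * i.φ kl.2 * pSeminorm i.n (partIS z) +
      i.ψ kl.1 * i.ψ kl.2 * ‖eval₁ z‖ := rfl

/-- The seminorms `α_{φ,ψ}` on families of smooth functions. -/
def alphaS (i : Param) : Seminorm ℂ SCoord := sumSeminorm (E := Smooth) (alphaTerm i)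

theorem sumSeminorm_mapRange {ι E F : Type*} [AddCommGroup E] [Module ℂ E] [AddCommGroup F]
    [Module ℂ F] (q : ι → Seminorm ℂ F) (f : E →ₗ[ℂ] F) (v : ι →₀ E) :
    sumSeminorm q (Finsupp.mapRange.linearMap f v) = sumSeminorm (fun i => (q i).comp f) v :=
  Finsupp.sum_mapRange_index (hf := map_zero f) (h := fun i z => q i z) fun i => map_zero (q i)

theorem alphaS_inclS (i : Param) (w : WPrime) : alphaS i (inclS w) = alpha i w := by
  change sumSeminorm (alphaTerm i) (Finsupp.mapRange.linearMap polySmooth.toLinearMap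
    (coordEquiv w)) = sumSeminorm _ (Finsupp.mapRange.linearMap partI (coordEquiv w)) +
      sumSeminorm _ (Finsupp.mapRange.linearMap (leval 1) (coordEquiv w))
  rw [sumSeminorm_mapRange, sumSeminorm_mapRange, sumSeminorm_mapRange,
    sumSeminorm_eq_sum _ _ le_rfl, sumSeminorm_eq_sum _ _ le_rfl, sumSeminorm_eq_sum _ _ le_rfl,
    ← Finset.sum_add_distrib]
  refine Finset.sum_congr rfl fun kl _ => ?_
  change alphaTerm i kl (polySmooth (coordEquiv w kl)) = _
  rw [alphaTerm_apply, partIS_polySmooth, eval₁_polySmooth]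
  rfl

/-- The constant is `1 + 2`, from `|z(1)| ≤ p_n(z)` and `p_n(t) ≤ 2`. -/
theorem pSeminorm_partIS_le (n : ℕ) (z : Smooth) :
    pSeminorm n (partIS z) ≤ 3 * pSeminorm n z := by
  rw [partIS_apply]
  refine (map_sub_le_add _ _ _).trans ?_
  rw [map_smul_eq_mul]
  have h1 : ‖eval₁ z‖ ≤ pSeminorm n z := norm_eval_le_pSeminorm 1 n z
  nlinarith [pSeminorm_t_le n, norm_nonneg (eval₁ z), apply_nonneg (pSeminorm n) Smooth.t]

theorem pSeminorm_le_partIS (n : ℕ) (z : Smooth) :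
    pSeminorm n z ≤ pSeminorm n (partIS z) + 2 * ‖eval₁ z‖ := by
  have h : z = partIS z + eval₁ z • Smooth.t := by rw [partIS_apply, sub_add_cancel]
  conv_lhs => rw [h]
  refine (map_add_le_add _ _ _).trans ?_
  rw [map_smul_eq_mul, mul_comm (2 : ℝ)]
  gcongr
  exact pSeminorm_t_le n

theorem alphaS_le_weighted (i : Param) (v : SCoord) : alphaS i v ≤ weighted pSeminorm
    (i.n, fun kl => 3 * (i.φ kl.1 * i.φ kl.2) + i.ψ kl.1 * i.ψ kl.2) v := by
  refine sumSeminorm_mono (E := Smooth) (fun kl z => ?_) v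
  rw [alphaTerm_apply]
  change _ ≤ ((3 * (i.φ kl.1 * i.φ kl.2) + i.ψ kl.1 * i.ψ kl.2 : NNReal) : ℝ) * pSeminorm i.n z
  push_cast
  rw [add_mul, mul_comm (3 : ℝ), mul_assoc _ (3 : ℝ)]
  gcongr
  · exact pSeminorm_partIS_le _ _
  · exact norm_eval_le_pSeminorm 1 _ _

theorem exists_weighted_le_alphaS (n : ℕ) (Φ : ℕ × ℕ → NNReal) :
    ∃ i : Param, ∀ v : SCoord, weighted pSeminorm (n, Φ) v ≤ alphaS i v := by
  -- The factor `2` compensates the `2 * ‖eval₁ z‖` in `pSeminorm_le_partIS`; the same `φ` then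
  -- serves as `ψ`.
  obtain ⟨φ, hmono, hbound, hΦ⟩ := exists_monotone_weight (fun kl => 2 * Φ kl)
    fun l => Real.toNNReal (Real.sqrt (2 * (l + 2).factorial))
  refine ⟨⟨n, φ, φ, hmono, fun l => Real.toNNReal_le_iff_le_coe.1 (hbound l)⟩,
    fun v => sumSeminorm_mono (E := Smooth) (fun kl z => ?_) v⟩
  rw [alphaTerm_apply]
  change (Φ kl : ℝ) * pSeminorm n z ≤ φ kl.1 * φ kl.2 * pSeminorm n (partIS z) +
    φ kl.1 * φ kl.2 * ‖eval₁ z‖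
  have h : 2 * (Φ kl : ℝ) ≤ φ kl.1 * φ kl.2 := by exact_mod_cast hΦ kl.1 kl.2
  have h0 : (0 : ℝ) ≤ Φ kl := NNReal.coe_nonneg _
  nlinarith [pSeminorm_le_partIS n z, norm_nonneg (eval₁ z), apply_nonneg (pSeminorm n) (partIS z),
    mul_le_mul_of_nonneg_left (pSeminorm_le_partIS n z) h0,
    mul_le_mul_of_nonneg_right h (norm_nonneg (eval₁ z)),
    mul_le_mul_of_nonneg_right h (apply_nonneg (pSeminorm n) (partIS z)),
    mul_nonneg h0 (apply_nonneg (pSeminorm n) (partIS z))]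

theorem withSeminorms_alphaS : WithSeminorms alphaS :=
  withSeminorms_of_le withSeminorms_SCoord
    (fun i => ⟨_, 1, fun v => (alphaS_le_weighted i v).trans (one_mul _).ge⟩)
    fun j => by
      obtain ⟨i, hi⟩ := exists_weighted_le_alphaS j.1 j.2
      exact ⟨i, 1, fun v => (hi v).trans (one_mul _).ge⟩

/-! #### Submultiplicativity on `I` -/

/-- When `b(1) = 0`, moving `x'` past `y'^(k+1) b(e)` leaves only `y'^k (e + k) b(e)`, whose
coefficient again vanishes at `1`. The `l` passages multiply `b` by the `t + k` with `j ≤ k < l +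
j`, and the product of the bounds `k + 2` is at most `(l+j+1)!`. -/
theorem exists_opXS_pow_eq (p j n : ℕ) (l : ℕ) (b : Smooth) (hb : eval₁ b = 0) :
    ∃ c : Smooth, eval₁ c = 0 ∧ pSeminorm p c ≤ (l + j + 1).factorial * pSeminorm p b ∧
      (opXS ^ l) (Finsupp.single (l + j, n) b) = Finsupp.single (j, n) c := by
  induction l generalizing b with
  | zero =>
    refine ⟨b, hb, ?_, by simp⟩
    refine le_mul_of_one_le_left (apply_nonneg _ _) ?_
    exact_mod_cast Nat.factorial_pos _
  | succ l ih =>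
    obtain ⟨c, hc, hle, h⟩ := ih ((Smooth.t + ((l + j : ℕ) : ℂ) • 1) * b) (by
      change Smooth.eval 1 (_ * b) = 0
      rw [map_mul]
      exact mul_eq_zero_of_right _ hb)
    refine ⟨c, hc, hle.trans ?_, ?_⟩
    · rw [show l + 1 + j + 1 = (l + j + 1) + 1 by ring, Nat.factorial_succ (l + j + 1),
        Nat.cast_mul, mul_comm ((l + j + 1 + 1 : ℕ) : ℝ), mul_assoc]
      refine mul_le_mul_of_nonneg_left ?_ (Nat.cast_nonneg _)
      refine (pSeminorm_mul_le p _ _).trans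
        (mul_le_mul_of_nonneg_right ?_ (apply_nonneg _ _))
      refine (pSeminorm_t_add_le p (l + j)).trans_eq ?_
      push_cast
      ring
    · rw [pow_succ, Module.End.mul_apply, show l + 1 + j = l + j + 1 by ring, opXS_single_succ, hb,
        zero_smul, Finsupp.single_zero, add_zero, h]

/-- After `m` passages all `y'` are used up, and the next `x'` meets some `c(e)` with `c(1) = 0`,
where `x' c(e) = c(1) x'`. -/
theorem opXS_pow_eq_zero (l m n : ℕ) (h : m < l) (b : Smooth) (hb : eval₁ b = 0) :
    (opXS ^ l) (Finsupp.single (m, n) b) = 0 := by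
  obtain ⟨d, rfl⟩ := Nat.exists_eq_add_of_lt h
  obtain ⟨c, hc, -, hX⟩ := exists_opXS_pow_eq 0 0 n m b hb
  rw [show m + d + 1 = d + 1 + m by ring, pow_add, Module.End.mul_apply]
  rw [add_zero] at hX
  rw [hX, pow_succ, Module.End.mul_apply, opXS_single_zero, hc, zero_smul, Finsupp.single_zero,
    map_zero]

theorem opYS_pow_single (k j l : ℕ) (z : Smooth) :
    (opYS ^ k) (Finsupp.single (j, l) z) = Finsupp.single (k + j, l) z := by
  induction k with
  | zero => simp
  | succ k ih => rw [pow_succ', Module.End.mul_apply, ih, opYS_single, add_right_comm]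

/-- The seminorm `v ↦ ∑ φ(k) φ(l) p_n(v_{kl})`. -/
def betaS (i : Param) : Seminorm ℂ SFam :=
  weighted pSeminorm (i.n, fun kl => i.φ kl.1 * i.φ kl.2)

theorem alphaS_eq_betaS (i : Param) (v : SCoord) (hv : ∀ kl, eval₁ (coeffS kl v) = 0) :
    alphaS i v = betaS i v := by
  refine Finset.sum_congr rfl fun kl _ => ?_
  have h : eval₁ ((show SFam from v) kl) = 0 := hv kl
  change alphaTerm i kl ((show SFam from v) kl) = _
  rw [alphaTerm_apply, partIS_apply, h, norm_zero, mul_zero, add_zero, zero_smul, sub_zero]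
  rfl

/-- The growth condition on `φ` enters the submultiplicativity only through this bound. -/
theorem Param.factorial_le (i : Param) (l : ℕ) : ((l + 1).factorial : ℝ) ≤ i.φ l * i.φ l := by
  have h1 := mul_self_le_mul_self (Real.sqrt_nonneg _) (i.bound l)
  rw [Real.mul_self_sqrt (by positivity)] at h1
  refine le_trans ?_ h1
  have : ((l + 1).factorial : ℝ) ≤ (l + 2).factorial :=
    Nat.cast_le.2 (Nat.factorial_le (Nat.le_succ _))
  linarith [Nat.cast_nonneg (α := ℝ) (l + 2).factorial]

/-- Only `l = m` gives a nonzero product. For `m < l` the power `x'^l` annihilates the right factor;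
for `m > l` a power of `y'` survives next to `a(e)` and turns it into `a(1) = 0`. For `l = m` the
factor `(l+1)!` is paid by the `φ(l) φ(m) = φ(l)^2` available on the right. -/
theorem betaS_mulS_single_le (i : Param) (k l m n : ℕ) {a b : Smooth} (ha : eval₁ a = 0)
    (hb : eval₁ b = 0) :
    betaS i (mulS (Finsupp.single (k, l) a) (Finsupp.single (m, n) b)) ≤
      (i.φ k * i.φ l * pSeminorm i.n a) * (i.φ m * i.φ n * pSeminorm i.n b) := by
  have hnn : 0 ≤ (i.φ k * i.φ l * pSeminorm i.n a) * (i.φ m * i.φ n * pSeminorm i.n b) := by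
    have := apply_nonneg (pSeminorm i.n) a
    have := apply_nonneg (pSeminorm i.n) b
    positivity
  rw [mulS_single]
  rcases lt_or_ge m l with h | h
  · rwa [opXS_pow_eq_zero l m n h b hb, map_zero, map_zero, map_zero]
  obtain ⟨j, rfl⟩ := Nat.exists_eq_add_of_le h
  obtain ⟨c, hc, hle, hX⟩ := exists_opXS_pow_eq i.n j n l b hb
  rw [hX]
  cases j with
  | succ j => rwa [opES_single_succ, ha, zero_smul, map_zero, map_zero]
  | zero =>
    rw [opES_single_zero, opYS_pow_single, betaS, weighted_single]
    simp only [add_zero, NNReal.coe_mul] at hle ⊢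
    have hab : pSeminorm i.n (a * c) ≤
        pSeminorm i.n a * (i.φ l * i.φ l * pSeminorm i.n b) :=
      (pSeminorm_mul_le _ _ _).trans (mul_le_mul_of_nonneg_left (hle.trans
        (mul_le_mul_of_nonneg_right (i.factorial_le l) (apply_nonneg _ _))) (apply_nonneg _ _))
    refine (mul_le_mul_of_nonneg_left hab (by positivity)).trans_eq ?_
    ring

theorem betaS_mulS_le (i : Param) (v w : SFam) (hv : ∀ kl, eval₁ (v kl) = 0)
    (hw : ∀ kl, eval₁ (w kl) = 0) : betaS i (mulS v w) ≤ betaS i v * betaS i w := by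
  have h : mulS v w = ∑ a ∈ v.support, ∑ b ∈ w.support,
      mulS (Finsupp.single a (v a)) (Finsupp.single b (w b)) := by
    conv_lhs => rw [← Finsupp.sum_single v, ← Finsupp.sum_single w]
    simp only [Finsupp.sum, map_sum, LinearMap.sum_apply]
    exact Finset.sum_comm
  rw [h, betaS, weighted_eq_sum _ _ _ v, weighted_eq_sum _ _ _ w, Finset.sum_mul_sum]
  refine (seminorm_sum_le _ _ _).trans (Finset.sum_le_sum fun a _ => ?_)
  refine (seminorm_sum_le _ _ _).trans (Finset.sum_le_sum fun b _ => ?_)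
  exact betaS_mulS_single_le i a.1 a.2 b.1 b.2 (hv a) (hw b)

/-! ### The topology of `W'` -/

theorem withSeminorms_alpha : WithSeminorms alpha := seminormUniformSpace_withSeminorms _

theorem isInducing_of_seminorm {E F ι : Type*} [AddCommGroup E] [Module ℂ E] [TopologicalSpace E]
    [AddCommGroup F] [Module ℂ F] [TopologicalSpace F] {p : ι → Seminorm ℂ E}
    {q : ι → Seminorm ℂ F} (hp : WithSeminorms p) (hq : WithSeminorms q) (f : E →ₗ[ℂ] F)
    (h : ∀ i x, q i (f x) = p i x) : IsInducing f := by
  have hpq : SeminormFamily.comp q f = p := funext fun i => Seminorm.ext fun x => h i x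
  have h' := f.withSeminorms_induced hq
  rw [hpq] at h'
  exact ⟨hp.withSeminorms_eq.trans (WithSeminorms.withSeminorms_eq (t := _) h').symm⟩

/-- The inclusion of `W'` into the algebra of families of smooth functions. -/
def incl : WPrime →ₙₐ[ℂ] SCoord where
  toFun w := inclS w
  map_smul' c w := map_smul inclS c (w : WTilde)
  map_zero' := map_zero inclS
  map_add' v w := map_add inclS (v : WTilde) w
  map_mul' v w := inclS_mul v w

theorem isEmbedding_incl : IsEmbedding incl :=
  ⟨isInducing_of_seminorm withSeminorms_alpha withSeminorms_alphaS
    (incl : WPrime →ₗ[ℂ] SCoord) alphaS_inclS,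
    fun _ _ h => Subtype.ext (inclS_injective h)⟩

instance : T2Space WPrime := isEmbedding_incl.t2Space

instance : ContinuousMul WPrime :=
  isEmbedding_incl.isInducing.continuousMul incl

theorem eval₁_coeffS_inclS (w : WTilde) (kl : ℕ × ℕ) :
    eval₁ (coeffS kl (inclS w)) = coordW (piTilde w) kl := by
  rw [coordW_piTilde]
  exact eval₁_polySmooth _

theorem mem_idealI {w : WPrime} : w ∈ idealI ↔ proj w = 0 := by
  change proj w ∈ (⊥ : NonUnitalSubalgebra ℂ W) ↔ _
  rw [NonUnitalAlgebra.mem_bot]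

theorem eval₁_coeffS_incl_idealI {w : WPrime} (hw : w ∈ idealI) (kl : ℕ × ℕ) :
    eval₁ (coeffS kl (incl w)) = 0 := by
  refine (eval₁_coeffS_inclS w kl).trans ?_
  rw [show piTilde w = 0 from mem_idealI.1 hw, map_zero]
  rfl

theorem alpha_mul_le (i : Param) {a b : WPrime} (ha : a ∈ idealI) (hb : b ∈ idealI) :
    alpha i (a * b) ≤ alpha i a * alpha i b := by
  have h : ∀ w ∈ idealI, alpha i w = betaS i (incl w) := fun w hw =>
    (alphaS_inclS i w).symm.trans (alphaS_eq_betaS i _ (eval₁_coeffS_incl_idealI hw))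
  rw [h _ (mul_mem ha hb), h a ha, h b hb, map_mul, SCoord.mul_def]
  exact betaS_mulS_le i _ _ (eval₁_coeffS_incl_idealI ha) (eval₁_coeffS_incl_idealI hb)

/-! #### The subalgebra `I₁` -/

theorem exists_mem_algI₁ (p : ℂ[X]) : ∃ w ∈ algI₁, (w : WTilde) = eT * aeval eT p := by
  induction p using Polynomial.induction_on' with
  | add p q hp hq =>
    obtain ⟨v, hv, hv'⟩ := hp
    obtain ⟨w, hw, hw'⟩ := hq
    exact ⟨v + w, add_mem hv hw, by rw [map_add, mul_add, ← hv', ← hw']; rfl⟩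
  | monomial n a =>
    have h : ∀ n : ℕ, ∃ w ∈ algI₁, (w : WTilde) = eT * eT ^ n := by
      intro n
      induction n with
      | zero => exact ⟨WPrime.e, e_mem_algI₁, by rw [pow_zero, mul_one]; rfl⟩
      | succ n ih =>
        obtain ⟨w, hw, hw'⟩ := ih
        exact ⟨w * WPrime.e, mul_mem hw e_mem_algI₁, by rw [pow_succ, ← mul_assoc, ← hw']; rfl⟩
    obtain ⟨w, hw, hw'⟩ := h n
    exact ⟨a • w, SMulMemClass.smul_mem a hw, by
      rw [aeval_monomial, ← Algebra.smul_def, mul_smul_comm, ← hw']; rfl⟩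

theorem exists_mem_algI₁_eq_aeval {p : ℂ[X]} (hp : p.eval 0 = 0) :
    ∃ w ∈ algI₁, (w : WTilde) = aeval eT p := by
  obtain ⟨q, rfl⟩ := (X_dvd_iff (f := p)).2 (by rwa [coeff_zero_eq_eval_zero])
  rw [map_mul, aeval_X]
  exact exists_mem_algI₁ q

theorem mem_algI₁ {w : WPrime} :
    w ∈ algI₁ ↔ ∃ p : ℂ[X], p.eval 0 = 0 ∧ (w : WTilde) = aeval eT p := by
  constructor
  · intro hw
    induction hw using NonUnitalAlgebra.adjoin_induction with
    | mem x hx =>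
      rw [Set.mem_singleton_iff.1 hx]
      exact ⟨X, eval_X, by rw [aeval_X]; rfl⟩
    | add x y _ _ hx hy =>
      obtain ⟨p, hp, hp'⟩ := hx
      obtain ⟨q, hq, hq'⟩ := hy
      exact ⟨p + q, by rw [eval_add, hp, hq, add_zero], by rw [map_add, ← hp', ← hq']; rfl⟩
    | zero => exact ⟨0, eval_zero, by rw [map_zero]; rfl⟩
    | mul x y _ _ hx hy =>
      obtain ⟨p, hp, hp'⟩ := hx
      obtain ⟨q, hq, hq'⟩ := hy
      exact ⟨p * q, by rw [eval_mul, hp, zero_mul], by rw [map_mul, ← hp', ← hq']; rfl⟩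
    | smul r x _ hx =>
      obtain ⟨p, hp, hp'⟩ := hx
      exact ⟨r • p, by rw [eval_smul, hp, smul_zero], by rw [map_smul, ← hp']; rfl⟩
  · rintro ⟨p, hp, hw⟩
    obtain ⟨v, hv, hv'⟩ := exists_mem_algI₁_eq_aeval hp
    rwa [Subtype.ext (hw.trans hv'.symm)]

theorem inclS_aeval (p : ℂ[X]) : inclS (aeval eT p) = singleS (0, 0) (polySmooth p) := by
  have : aeval eT p = ofCoord (Finsupp.single (0, 0) p) := by rw [ofCoord_single]; simp
  rw [this, inclS_ofCoord, polyFam_single]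
  rfl

theorem singleS_mul (a b : Smooth) :
    singleS (0, 0) (a * b) = singleS (0, 0) a * singleS (0, 0) b := by
  have h : mulS (Finsupp.single (0, 0) a) (Finsupp.single (0, 0) b) =
      Finsupp.single (0, 0) (a * b) := by
    rw [mulS_single, pow_zero, pow_zero, Module.End.one_apply, Module.End.one_apply,
      opES_single_zero]
  exact h.symm

theorem incl_algI₁ {w : WPrime} (hw : w ∈ algI₁) :
    incl w = singleS (0, 0) (coeffS (0, 0) (incl w)) := by
  obtain ⟨p, -, hp⟩ := mem_algI₁.1 hw
  have : incl w = singleS (0, 0) (polySmooth p) := by rw [← inclS_aeval, ← hp]; rfl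
  rw [this, coeffS_singleS]

theorem eval_zero_coeffS_incl_algI₁ {w : WPrime} (hw : w ∈ algI₁) :
    Smooth.eval 0 (coeffS (0, 0) (incl w)) = 0 := by
  obtain ⟨p, hp0, hp⟩ := mem_algI₁.1 hw
  have : incl w = singleS (0, 0) (polySmooth p) := by rw [← inclS_aeval, ← hp]; rfl
  rw [this, coeffS_singleS, eval_polySmooth]
  simpa using hp0

/-- The homomorphism `I₁ → C^∞[0,1]` with `1 + f ↦ t`. -/
def kappa : algI₁ →ₙₐ[ℂ] Smooth where
  toFun w := coeffS (0, 0) (incl w)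
  map_smul' c w := by
    change coeffS (0, 0) (incl (c • (w : WPrime))) = c • _
    rw [map_smul, map_smul]
  map_zero' := by
    change coeffS (0, 0) (incl (0 : WPrime)) = 0
    rw [map_zero, map_zero]
  map_add' v w := by
    change coeffS (0, 0) (incl ((v : WPrime) + w)) = _
    rw [map_add, map_add]
  map_mul' v w := by
    change coeffS (0, 0) (incl ((v : WPrime) * w)) = _
    rw [map_mul, incl_algI₁ v.2, incl_algI₁ w.2, ← singleS_mul, coeffS_singleS, coeffS_singleS,
      coeffS_singleS]

theorem incl_e : incl WPrime.e = singleS (0, 0) Smooth.t := by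
  change inclS eT = _
  have := inclS_aeval X
  rwa [aeval_X, polySmooth_X] at this

theorem kappa_e : kappa ⟨WPrime.e, e_mem_algI₁⟩ = Smooth.t := by
  change coeffS (0, 0) (incl WPrime.e) = _
  rw [incl_e, coeffS_singleS]

/-- Followed by the embedding of the coordinate `(0,0)`, `kappa` becomes the restriction of the
embedding `incl` to `I₁`. -/
theorem isEmbedding_kappa : IsEmbedding kappa := by
  have h : singleS (0, 0) ∘ kappa = incl ∘ ((↑) : algI₁ → WPrime) :=
    funext fun w => (incl_algI₁ w.2).symm
  refine (isEmbedding_singleS (0, 0)).of_comp_iff.1 ?_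
  rw [h]
  exact isEmbedding_incl.comp .subtypeVal

/-! ### The splitting -/

theorem yT_pow_mul_mem (k : ℕ) {w : WTilde} (hw : w ∈ WPrime) : yT ^ k * w ∈ WPrime := by
  induction k with
  | zero => rwa [pow_zero, one_mul]
  | succ k ih => rw [pow_succ', mul_assoc]; exact mul_mem yT_mem ih

theorem mul_xT_pow_mem (k : ℕ) {w : WTilde} (hw : w ∈ WPrime) : w * xT ^ k ∈ WPrime := by
  induction k with
  | zero => rwa [pow_zero, mul_one]
  | succ k ih => rw [pow_succ, ← mul_assoc]; exact mul_mem ih xT_mem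

/-- `∑ λ_{kl} y^k x^l ↦ ∑ λ_{kl} y'^k (1 + f) x'^l`, in coordinates. -/
def liftCoord : (ℕ × ℕ →₀ ℂ) →ₗ[ℂ] WTilde :=
  Finsupp.lsum ℂ fun kl => LinearMap.toSpanSingleton ℂ WTilde (yT ^ kl.1 * eT * xT ^ kl.2)

theorem liftCoord_single (k l : ℕ) (c : ℂ) :
    liftCoord (Finsupp.single (k, l) c) = c • (yT ^ k * eT * xT ^ l) := by
  simp [liftCoord]

theorem liftCoord_mem (v : ℕ × ℕ →₀ ℂ) : liftCoord v ∈ WPrime := by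
  induction v using Finsupp.induction_linear with
  | zero => rw [map_zero]; exact zero_mem _
  | add f g hf hg => rw [map_add]; exact add_mem hf hg
  | single kl c =>
    rw [← Prod.mk.eta (p := kl), liftCoord_single]
    exact SMulMemClass.smul_mem c (mul_xT_pow_mem _ (yT_pow_mul_mem _ eT_mem))

theorem piTilde_liftCoord (v : ℕ × ℕ →₀ ℂ) : piTilde (liftCoord v) = ofCoordW v := by
  induction v using Finsupp.induction_linear with
  | zero => simp
  | add f g hf hg => rw [map_add, map_add, map_add, hf, hg]
  | single kl c =>
    rw [← Prod.mk.eta (p := kl), liftCoord_single, ofCoordW_single, map_smul, map_mul, map_mul,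
      map_pow, map_pow, piTilde_xT, piTilde_yT, piTilde_eT, mul_one]

/-- The linear splitting `y^n x^m ↦ y'^n (1 + f) x'^m` of `π`. -/
def split : W →ₗ[ℂ] WPrime :=
  LinearMap.codRestrict WPrime.toSubmodule (liftCoord ∘ₗ coordW.toLinearMap)
    fun _ => liftCoord_mem _

theorem split_apply (n m : ℕ) :
    (split (W.y ^ n * W.x ^ m) : WTilde) = yT ^ n * eT * xT ^ m := by
  have h : W.y ^ n * W.x ^ m = coordW.symm (Finsupp.single (n, m) 1) := by
    rw [coordW_symm_apply, ofCoordW_single, one_smul]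
  change liftCoord (coordW _) = _
  rw [h, LinearEquiv.apply_symm_apply, liftCoord_single, one_smul]

theorem proj_split (c : W) : proj (split c) = c := by
  change piTilde (liftCoord (coordW c)) = c
  rw [piTilde_liftCoord, ← coordW_symm_apply, LinearEquiv.symm_apply_apply]

theorem continuous_split : Continuous split := continuous_of_fine withSeminorms_alpha split

/-- The extension of `π` to families of smooth functions. -/
def projLinS : SCoord →ₗ[ℂ] W := ofCoordW ∘ₗ Finsupp.mapRange.linearMap eval₁

theorem projLinS_inclS (w : WTilde) : projLinS (inclS w) = piTilde w := by
  have h : Finsupp.mapRange.linearMap eval₁ (inclS w) = coordW (piTilde w) :=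
    Finsupp.ext fun kl => eval₁_coeffS_inclS w kl
  change ofCoordW (Finsupp.mapRange.linearMap eval₁ (inclS w)) = _
  rw [h, ← coordW_symm_apply, LinearEquiv.symm_apply_apply]

theorem continuous_projLinS : Continuous projLinS := by
  refine continuous_of_seminorm_le withSeminorms_W projLinS fun p => ?_
  obtain ⟨Φ, hΦ⟩ := exists_le_weightedW p ofCoordW
  refine ⟨_, withSeminorms_SCoord.continuous_seminorm (0, Φ), fun v => (hΦ _).trans
    ((sumSeminorm_mapRange (fun i => Φ i • normSeminorm ℂ ℂ) eval₁ v).trans_le ?_)⟩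
  exact sumSeminorm_mono (fun _ _ => mul_le_mul_of_nonneg_left
    (norm_eval_le_pSeminorm 1 0 _) (NNReal.coe_nonneg _)) v

/-- The extension of `π` to families of smooth functions, as a homomorphism. -/
def projS : SCoord →ₙₐ[ℂ] W where
  toFun := projLinS
  map_smul' := map_smul projLinS
  map_zero' := map_zero projLinS
  map_add' := map_add projLinS
  map_mul' a b := by
    have := continuous_projLinS
    refine DenseRange.induction_on₂ (p := fun a b => projLinS (a * b) = projLinS a * projLinS b)
      denseRange_inclS (isClosed_eq (by fun_prop) (by fun_prop)) (fun _ _ => ?_) a b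
    rw [← inclS_mul, projLinS_inclS, projLinS_inclS, projLinS_inclS, map_mul]

theorem projS_incl (w : WPrime) : projS (incl w) = proj w := projLinS_inclS w

theorem continuous_projS : Continuous projS := continuous_projLinS

theorem continuous_proj : Continuous proj := by
  have h : (proj : WPrime → W) = projS ∘ incl := funext fun w => (projS_incl w).symm
  rw [h]
  exact continuous_projS.comp isEmbedding_incl.continuous

/-- The inverse is `w ↦ (w - s(π w), π w)`, continuous because `π` and `s` are. -/
theorem isHomeomorph_add_split :
    IsHomeomorph fun p : idealI × W => (p.1 : WPrime) + split p.2 := by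
  have h1 : ∀ p : idealI × W, proj ((p.1 : WPrime) + split p.2) = p.2 := fun p => by
    rw [map_add, proj_split, mem_idealI.1 p.1.2, zero_add]
  have h2 : ∀ w, w - split (proj w) ∈ idealI := fun w => mem_idealI.2 (by
    rw [map_sub, proj_split, sub_self])
  have hs := continuous_split
  have hp := continuous_proj
  exact Homeomorph.isHomeomorph
    { toFun := fun p : idealI × W => (p.1 : WPrime) + split p.2
      invFun := fun w => (⟨w - split (proj w), h2 w⟩, proj w)
      left_inv := fun p => Prod.ext (Subtype.ext (by
        change (p.1 : WPrime) + split p.2 - split (proj ((p.1 : WPrime) + split p.2)) = p.1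
        rw [h1, add_sub_cancel_right])) (h1 p)
      right_inv := fun w => sub_add_cancel w _
      continuous_toFun := by fun_prop
      continuous_invFun := by fun_prop }

/-! ### The completion -/

theorem NonUnitalSubalgebra.locallyConvexAlgebra {A : Type*} [NonUnitalRing A] [Module ℂ A]
    [UniformSpace A] [LocallyConvexAlgebra A] (S : NonUnitalSubalgebra ℂ A)
    (hS : IsClosed (S : Set A)) : LocallyConvexAlgebra S := by
  have : IsUniformAddGroup S := S.toSubmodule.toAddSubgroup.isUniformAddGroup
  have : CompleteSpace S := hS.completeSpace_coe
  have hw := LinearMap.withSeminorms_induced (PolynormableSpace.withSeminorms ℂ A)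
    S.toSubmodule.subtype
  exact locallyConvexAlgebra_of hw

/-- The inequality is a closed condition on the pair `(a, b)`. -/
theorem NonUnitalSubalgebra.seminorm_mul_le_of_mem_closure {A : Type*} [NonUnitalRing A]
    [Module ℂ A] [UniformSpace A] [LocallyConvexAlgebra A] {p : Seminorm ℂ A} (hp : Continuous p)
    (T : NonUnitalSubalgebra ℂ A) (h : ∀ a ∈ T, ∀ b ∈ T, p (a * b) ≤ p a * p b) {a b : A}
    (ha : a ∈ T.topologicalClosure) (hb : b ∈ T.topologicalClosure) :
    p (a * b) ≤ p a * p b := by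
  have hab : (a, b) ∈ closure ((T : Set A) ×ˢ (T : Set A)) := by
    rw [closure_prod_eq]
    exact ⟨ha, hb⟩
  exact closure_minimal (t := {x : A × A | p (x.1 * x.2) ≤ p x.1 * p x.2})
    (fun x hx => h x.1 hx.1 x.2 hx.2) (isClosed_le (by fun_prop) (by fun_prop)) hab

theorem NonUnitalSubalgebra.isMAlgebra_topologicalClosure {A ι : Type*} [NonUnitalRing A]
    [Module ℂ A] [UniformSpace A] [LocallyConvexAlgebra A] {p : ι → Seminorm ℂ A}
    (hp : WithSeminorms p) (T : NonUnitalSubalgebra ℂ A)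
    (h : ∀ i, ∀ a ∈ T, ∀ b ∈ T, p i (a * b) ≤ p i a * p i b) :
    IsMAlgebra T.topologicalClosure := by
  have := NonUnitalSubalgebra.locallyConvexAlgebra T.topologicalClosure
    (NonUnitalSubalgebra.isClosed_topologicalClosure _)
  have hw : WithSeminorms fun i => (p i).comp T.topologicalClosure.toSubmodule.subtype :=
    LinearMap.withSeminorms_induced hp T.topologicalClosure.toSubmodule.subtype
  refine { exists_submultiplicative :=
    ⟨Set.range fun i => (p i).comp T.topologicalClosure.toSubmodule.subtype, ?_, ?_⟩ }
  · refine withSeminorms_of_le hw (fun q => ?_) fun i => ?_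
    · obtain ⟨_, i, rfl⟩ := q
      exact ⟨i, 1, fun v => (one_mul _).ge⟩
    · exact ⟨⟨_, i, rfl⟩, 1, fun v => (one_mul _).ge⟩
  · rintro _ ⟨i, rfl⟩ a b
    exact NonUnitalSubalgebra.seminorm_mul_le_of_mem_closure (hp.continuous_seminorm i) T (h i)
      a.2 b.2

/-- The range of `W'` in the algebra of families of smooth functions. -/
def WBarSub : NonUnitalSubalgebra ℂ SCoord :=
  (NonUnitalAlgHom.range incl).topologicalClosure

/-- The completion of `W'`. -/
abbrev WBar : Type := WBarSub

instance : LocallyConvexAlgebra WBar :=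
  NonUnitalSubalgebra.locallyConvexAlgebra _ (NonUnitalSubalgebra.isClosed_topologicalClosure _)

theorem incl_mem (w : WPrime) : incl w ∈ WBarSub :=
  NonUnitalSubalgebra.le_topologicalClosure _ ⟨w, rfl⟩

/-- The inclusion of `W'` into its completion. -/
def inclBar : WPrime →ₙₐ[ℂ] WBar := NonUnitalAlgHom.codRestrict incl WBarSub incl_mem

theorem isEmbedding_inclBar : IsEmbedding inclBar :=
  IsEmbedding.subtypeVal.of_comp_iff.1 isEmbedding_incl

theorem denseRange_inclBar : DenseRange inclBar := by
  intro v
  rw [closure_subtype]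
  have h : ((↑) : WBar → SCoord) '' Set.range inclBar = Set.range incl := by
    rw [← Set.range_comp]; rfl
  rw [h]
  exact v.2

/-- The extension of `π` to the completion. -/
def projBar : WBar →ₙₐ[ℂ] W := projS.comp (NonUnitalSubalgebraClass.subtype WBarSub)

theorem continuous_projBar : Continuous projBar := continuous_projS.comp continuous_subtype_val

theorem projBar_inclBar (w : WPrime) : projBar (inclBar w) = proj w := projS_incl w

/-- The splitting of the completed extension. -/
def splitBar : W →L[ℂ] WBar where
  toFun c := inclBar (split c)
  map_add' c d := by rw [map_add, map_add]
  map_smul' r c := by rw [map_smul, map_smul]; rfl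
  cont := isEmbedding_inclBar.continuous.comp continuous_split

theorem splitBar_apply (c : W) : splitBar c = inclBar (split c) := rfl

theorem projBar_splitBar (c : W) : projBar (splitBar c) = c := by
  rw [splitBar_apply, projBar_inclBar, proj_split]

/-- For the nontrivial inclusion: `v ↦ v - splitBar (projBar v)` is continuous, sends the dense
image of `W'` into the image of `I`, and fixes the kernel pointwise. -/
theorem projBar_eq_zero_iff (v : WBar) :
    projBar v = 0 ↔ v ∈ (idealI.map inclBar).topologicalClosure := by
  have hp := continuous_projBar
  constructor
  · intro hv
    have hc : Continuous fun v : WBar => v - splitBar (projBar v) := by fun_prop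
    have h := map_mem_closure (t := (idealI.map inclBar : Set WBar)) hc (denseRange_inclBar v) ?_
    · simp only [hv, map_zero, sub_zero] at h
      exact h
    · rintro _ ⟨w, rfl⟩
      refine ⟨w - split (proj w), mem_idealI.2 (by rw [map_sub, proj_split, sub_self]), ?_⟩
      change inclBar (w - split (proj w)) = inclBar w - splitBar (projBar (inclBar w))
      rw [map_sub, projBar_inclBar, splitBar_apply]
  · intro hv
    refine closure_minimal (t := {v | projBar v = 0}) ?_ (isClosed_eq hp continuous_const) hv
    rintro _ ⟨w, hw, rfl⟩
    exact (projBar_inclBar w).trans (mem_idealI.1 hw)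

/-- The extension of the seminorms `α_{φ,ψ}` to the completion. -/
def alphaBar (i : Param) : Seminorm ℂ WBar := (alphaS i).comp WBarSub.toSubmodule.subtype

theorem withSeminorms_alphaBar : WithSeminorms alphaBar :=
  LinearMap.withSeminorms_induced withSeminorms_alphaS WBarSub.toSubmodule.subtype

theorem alphaBar_inclBar (i : Param) (w : WPrime) : alphaBar i (inclBar w) = alpha i w :=
  alphaS_inclS i w

theorem isMAlgebra_closure_idealI : IsMAlgebra (idealI.map inclBar).topologicalClosure := by
  refine NonUnitalSubalgebra.isMAlgebra_topologicalClosure withSeminorms_alphaBar _ ?_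
  rintro i _ ⟨v, hv, rfl⟩ _ ⟨w, hw, rfl⟩
  change alphaBar i (inclBar v * inclBar w) ≤ alphaBar i (inclBar v) * alphaBar i (inclBar w)
  rw [← map_mul, alphaBar_inclBar, alphaBar_inclBar, alphaBar_inclBar]
  exact alpha_mul_le i hv hw

/-! #### The completion of `I₁` -/

theorem mem_smoothVanishing {g : Smooth} : g ∈ smoothVanishing ↔ Smooth.eval 0 g = 0 := Iff.rfl

theorem singleS_mem_closure {g : Smooth} (hg : g ∈ smoothVanishing) :
    singleS (0, 0) g ∈ closure (incl '' (algI₁ : Set WPrime)) := by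
  refine map_mem_closure (continuous_singleS (0, 0))
    (mem_closure_polySmooth_vanishing (mem_smoothVanishing.1 hg)) ?_
  rintro _ ⟨p, hp, rfl⟩
  obtain ⟨w, hw, hwp⟩ := exists_mem_algI₁_eq_aeval (p := p) hp
  exact ⟨w, hw, by rw [← inclS_aeval, ← hwp]; rfl⟩

theorem singleS_mem {g : Smooth} (hg : g ∈ smoothVanishing) : singleS (0, 0) g ∈ WBarSub :=
  closure_mono (Set.image_subset_range _ _) (singleS_mem_closure hg)

/-- The embedding of `{g ∈ C^∞[0,1] : g(0) = 0}` with `t ↦ 1 + f`. -/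
def theta : smoothVanishing →ₙₐ[ℂ] WBar where
  toFun g := ⟨singleS (0, 0) g, singleS_mem g.2⟩
  map_smul' c g := Subtype.ext (map_smul (singleS (0, 0)) c (g : Smooth))
  map_zero' := Subtype.ext (map_zero (singleS (0, 0)))
  map_add' g h := Subtype.ext (map_add (singleS (0, 0)) (g : Smooth) h)
  map_mul' g h := Subtype.ext (singleS_mul g h)

theorem isEmbedding_theta : IsEmbedding theta :=
  IsEmbedding.subtypeVal.of_comp_iff.1
    ((isEmbedding_singleS (0, 0)).comp (IsEmbedding.subtypeVal (p := (· ∈ smoothVanishing))))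

theorem theta_t : theta ⟨Smooth.t, t_mem_smoothVanishing⟩ = inclBar WPrime.e :=
  Subtype.ext incl_e.symm

theorem range_theta : Set.range theta = closure (inclBar '' (algI₁ : Set WPrime)) := by
  refine Set.Subset.antisymm ?_ ?_
  · rintro _ ⟨g, rfl⟩
    rw [closure_subtype, Set.image_image]
    exact singleS_mem_closure g.2
  · intro v hv
    have hc : Continuous fun v : WBar => coeffS (0, 0) (v : SCoord) :=
      (continuous_coeffS _).comp continuous_subtype_val
    -- Being concentrated in the coordinate `(0,0)`, with an entry that vanishes at `0`, is a closed
    -- condition satisfied on `I₁`.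
    have hmem : v ∈ {v : WBar | (v : SCoord) = singleS (0, 0) (coeffS (0, 0) (v : SCoord)) ∧
        Smooth.eval 0 (coeffS (0, 0) (v : SCoord)) = 0} := by
      refine closure_minimal ?_ ((isClosed_eq continuous_subtype_val
        ((continuous_singleS _).comp hc)).inter (isClosed_eq
          ((continuous_eval 0).comp hc) continuous_const)) hv
      rintro _ ⟨w, hw, rfl⟩
      exact ⟨incl_algI₁ hw, eval_zero_coeffS_incl_algI₁ hw⟩
    exact ⟨⟨_, mem_smoothVanishing.2 hmem.2⟩, Subtype.ext hmem.1.symm⟩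

/-- The embedding `g ↦ θ(∫₀ g)` of `C^∞[0,1]`. -/
def thetaJ : Smooth →L[ℂ] WBar where
  toFun g := theta ⟨g.J, mem_smoothVanishing.2 g.J_eval_zero⟩
  map_add' g h := by
    rw [← map_add]
    exact congrArg theta (Subtype.ext (map_add Smooth.J g h))
  map_smul' c g := by
    rw [RingHom.id_apply, ← map_smul]
    exact congrArg theta (Subtype.ext (map_smul Smooth.J c g))
  cont := isEmbedding_theta.continuous.comp (continuous_J.subtype_mk _)

theorem isEmbedding_thetaJ : IsEmbedding thetaJ :=
  isEmbedding_theta.comp (IsEmbedding.subtypeVal.of_comp_iff.1 isEmbedding_J)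

/-- Every `g` with `g(0) = 0` is the integral of its derivative, so `thetaJ` has the same range as
`theta`. -/
theorem range_thetaJ : Set.range thetaJ = closure (inclBar '' (algI₁ : Set WPrime)) := by
  rw [← range_theta]
  refine Set.Subset.antisymm ?_ ?_
  · rintro _ ⟨g, rfl⟩
    exact ⟨_, rfl⟩
  · rintro _ ⟨g, rfl⟩
    refine ⟨(g : Smooth).D, congrArg theta (Subtype.ext ?_)⟩
    change (g : Smooth).D.J = g
    rw [Smooth.J_D, mem_smoothVanishing.1 g.2, zero_smul, sub_zero]

end WeylExtension

end

/-- The locally convex structure on `W'` defined by the seminorms `α_{φ,ψ}`, its restrictions to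
`I`, `W` and `I₁`, and the completed extension `0 → Ī → W̄' → W → 0`. -/
theorem mainTheorem7 :
    -- The topology of `W'` is the one given by the seminorms `α_{φ,ψ}`; it is Hausdorff.
    WithSeminorms alpha ∧ T2Space WPrime ∧
    -- Multiplication is jointly continuous.
    ContinuousMul WPrime ∧
    -- All seminorms are submultiplicative on `I`.
    (∀ i : Param, ∀ a ∈ idealI, ∀ b ∈ idealI, alpha i (a * b) ≤ alpha i a * alpha i b) ∧
    -- `W` with the fine topology is a (complete) locally convex algebra.
    LocallyConvexAlgebra W ∧
    -- `I₁` carries the topology induced from `C^∞[0,1]` by `1 + f ↦ t`.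
    (∃ κ : algI₁ →ₙₐ[ℂ] Smooth, κ ⟨WPrime.e, e_mem_algI₁⟩ = Smooth.t ∧
      Topology.IsEmbedding κ) ∧
    -- `W' = I ⊕ W` topologically, through the splitting `s`.
    ∃ s : W →ₗ[ℂ] WPrime,
      (∀ n m : ℕ, (s (W.y ^ n * W.x ^ m) : WTilde) = yT ^ n * eT * xT ^ m) ∧
      (∀ c : W, proj (s c) = c) ∧
      IsHomeomorph (fun p : idealI × W => (p.1 : WPrime) + s p.2) ∧
      -- The completion `ι : W' → B` of `W'` as a locally convex algebra.
      ∃ (B : Type) (_ : NonUnitalRing B) (_ : Module ℂ B) (_ : UniformSpace B)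
        (_ : LocallyConvexAlgebra B) (ι : WPrime →ₙₐ[ℂ] B),
        Topology.IsEmbedding ι ∧ DenseRange ι ∧
        -- The linearly split extension `0 → Ī → B → W → 0`.
        (∃ πB : B →ₙₐ[ℂ] W, Continuous πB ∧ Function.Surjective πB ∧
          (∀ w : WPrime, πB (ι w) = proj w) ∧
          (∀ v : B, πB v = 0 ↔ v ∈ (idealI.map ι).topologicalClosure) ∧
          ∃ σ : W →L[ℂ] B, (∀ c : W, πB (σ c) = c) ∧ ∀ c : W, σ c = ι (s c)) ∧
        -- `Ī` is an `m`-algebra.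
        IsMAlgebra (idealI.map ι).topologicalClosure ∧
        -- The completion of `I₁` is, as a topological algebra with `1 + f ↦ t`, the algebra of
        -- all `g ∈ C^∞[0,1]` with `g(0) = 0`, and as a locally convex space it is `C^∞[0,1]`.
        (∃ Θ : smoothVanishing →ₙₐ[ℂ] B, Topology.IsEmbedding Θ ∧
          Θ ⟨Smooth.t, t_mem_smoothVanishing⟩ = ι WPrime.e ∧
          Set.range Θ = closure (ι '' (algI₁ : Set WPrime))) ∧
        (∃ L : Smooth →L[ℂ] B, Topology.IsEmbedding L ∧
          Set.range L = closure (ι '' (algI₁ : Set WPrime))) := by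

  refine ⟨withSeminorms_alpha, inferInstance, inferInstance,
    fun i a ha b hb => alpha_mul_le i ha hb, inferInstance,
    ⟨kappa, kappa_e, isEmbedding_kappa⟩, split, split_apply, proj_split, isHomeomorph_add_split,
    WBar, inferInstance, inferInstance, inferInstance, inferInstance, inclBar,
    isEmbedding_inclBar, denseRange_inclBar, ?_, isMAlgebra_closure_idealI,
    ⟨theta, isEmbedding_theta, theta_t, range_theta⟩,
    ⟨thetaJ, isEmbedding_thetaJ, range_thetaJ⟩⟩
  exact ⟨projBar, continuous_projBar, fun c => ⟨splitBar c, projBar_splitBar c⟩, projBar_inclBar,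
    projBar_eq_zero_iff, splitBar, projBar_splitBar, splitBar_apply⟩
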